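/- A polytope is the convex hull of a finite set of points in some $\mathbb{R}^d$. An extension of a polytope $P\subset\mathbb{R}^n$ is a polytope $Q\subset\mathbb{R}^d$ (for some $d$) together with a linear map $\pi:\mathbb{R}^d\to\mathbb{R}^n$ such that $\pi(Q)=P$; the extension complexity of $P$ is the smallest number of facets of an extension of $P$. A convex $n$-gon ($n\ge 3$) is the convex hull of $n$ points of $\mathbb{R}^2$ none of which lies in the convex hull of the others. (1) If $m>\exp\exp\exp\exp\exp\exp 40$, then the extension complexity of every convex $m$-gon is at most $25\,m\,(\ln\ln\ln\ln\ln\ln m)^{-1/2}$. (2) Consequently, every convex $n$-gon is a projection of a polytope with $o(n)$ facets: there is a function $f:\mathbb{N}\to\mathbb{N}$ with $f(n)=o(n)$ as $n\to\infty$ such that every convex $n$-gon, $n\ge 3$, has an extension with at most $f(n)$ facets. (3) In particular, convex polygons do not need linearly many inequalities in the worst case: there is no constant $c>0$ such that, for infinitely many $n$, some convex $n$-gon has extension complexity at least $cn$. -/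

import Mathlib

open Filter Asymptotics
open scoped ENNReal

/-- A polytope is the convex hull of a finite set of points. -/
def IsPolytope {E : Type*} [AddCommGroup E] [Module ℝ E] (P : Set E) : Prop :=
  ∃ V : Finset E, P = convexHull ℝ (V : Set E)

/-- A facet of `Q` is a nonempty (exposed) face whose dimension is one less than that of `Q`.
The dimension of a set is the dimension of the direction of its affine span.
All faces of a polytope are exposed. -/
def IsFacet {E : Type*} [AddCommGroup E] [Module ℝ E] [TopologicalSpace E]
    (Q F : Set E) : Prop :=
  IsExposed ℝ Q F ∧ F.Nonempty ∧
    Module.finrank ℝ (vectorSpan ℝ F) + 1 = Module.finrank ℝ (vectorSpan ℝ Q)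

/-- The number of facets of `Q`. -/
noncomputable def numFacets {E : Type*} [AddCommGroup E] [Module ℝ E] [TopologicalSpace E]
    (Q : Set E) : ℕ∞ :=
  {F : Set E | IsFacet Q F}.encard

/-- `Q ⊆ ℝ^d`, together with the linear map `π`, is a linear extended formulation
(an extension) of `P ⊆ ℝ^n`: it is a polytope that `π` maps onto `P`. -/
def IsExtension {n d : ℕ} (P : Set (Fin n → ℝ)) (Q : Set (Fin d → ℝ))
    (π : (Fin d → ℝ) →ₗ[ℝ] (Fin n → ℝ)) : Prop :=
  IsPolytope Q ∧ π '' Q = P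

/-- The extension complexity of `P`: the smallest number of facets of an extension of `P`
(`⊤` if there is no extension with finitely many facets). -/
noncomputable def extensionComplexity {n : ℕ} (P : Set (Fin n → ℝ)) : ℕ∞ :=
  ⨅ (d : ℕ) (Q : Set (Fin d → ℝ)) (π : (Fin d → ℝ) →ₗ[ℝ] (Fin n → ℝ))
    (_ : IsExtension P Q π), numFacets Q

/-- `P` is a convex `n`-gon: `n ≥ 3` and `P` is the convex hull of `n` points of the plane
in convex position, that is, none of them lies in the convex hull of the others. -/
def IsConvexPolygon (n : ℕ) (P : Set (Fin 2 → ℝ)) : Prop :=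
  3 ≤ n ∧ ∃ V : Finset (Fin 2 → ℝ), V.card = n ∧
    ConvexIndependent ℝ (Subtype.val : {x // x ∈ V} → (Fin 2 → ℝ)) ∧
    P = convexHull ℝ (V : Set (Fin 2 → ℝ))

/-! The trivial extension of a polygon spends one inequality per vertex. The saving comes from
special subsets: for fixed `s`, among sufficiently many points in convex position there are `s * (s
+ 1)` that can be captured by `4 * s` inequalities. Such subsets are removed one after another, the
boundedly many leftover points are lifted trivially, and the lifts are combined by adding
homogenized cones (`HasConeLift.add`). This costs about `4 * n / (s + 1)` plus a constant depending
on `s` (`exists_hasConeLift_coneOver`), and `s` may be as large as desired. Working with cones makes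
projective maps linear; the polytope is recovered as a slice at height one, which has at most as
many facets as there are inequalities.

The special subsets come from lacunary chains, points `(x i, r i * x i)` with `x` and `r` at least
doubling. In `IsLacunary.exists_hasConeLift` the `s * (s + 2)` edges are cut into `s` blocks. Each
block is enclosed in a triangle spanned by two of its points and the intersection of its outermost
edge lines, and a point of the lift is a nonnegative weight on the `3 * s` corners. What remains to
be enforced are the `s` inner edges of every block, `s ^ 2` conditions. By lacunarity
(`edge_mul_edge_le`) the forms of the `b`-th inner edges of all blocks can be scaled so that on each
triangle its own form is the smallest. A single inequality, which applies to the share of each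
triangle its own form, then implies the `b`-th edge inequality of every block; so `s` further
inequalities suffice.

Lacunary chains are found by a Ramsey argument: `exists_growth_or_decay` extracts from an increasing
sequence a subsequence whose gaps grow or shrink geometrically. It is applied to the edge slopes,
the abscissae and the ordinates of a convex chain, and each use costs an exponential. This is the
source of the iterated logarithm. -/

/-- The slice at height one of the polyhedral cone cut out by the linear forms `f i`. -/
def coneSlice {ι V : Type*} [AddCommGroup V] [Module ℝ V] (f : ι → V →ₗ[ℝ] ℝ) (τ : V →ₗ[ℝ] ℝ) :
    Set V :=
  {v | (∀ i, 0 ≤ f i v) ∧ τ v = 1}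

/-! ### Slices of polyhedral cones and their facets -/

section Slice

variable {ι E : Type*} [NormedAddCommGroup E] [NormedSpace ℝ E]
  {f : ι → E →ₗ[ℝ] ℝ} {τ : E →ₗ[ℝ] ℝ}

lemma convex_coneSlice : Convex ℝ (coneSlice f τ) := by
  intro x hx y hy a b ha hb hab
  refine ⟨fun i => ?_, ?_⟩
  · have h1 := mul_nonneg ha (hx.1 i)
    have h2 := mul_nonneg hb (hy.1 i)
    simpa using add_nonneg h1 h2
  · simp [hx.2, hy.2, hab]

/-- From a point of the slice one can move a little in every direction on which `τ` and the forms
that vanish at the point vanish. -/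
lemma exists_pos_add_smul_mem_coneSlice [Finite ι] {x d : E} (hx : x ∈ coneSlice f τ)
    (hd : ∀ i, f i x = 0 → f i d = 0) (hτ : τ d = 0) :
    ∃ ε : ℝ, 0 < ε ∧ x + ε • d ∈ coneSlice f τ ∧ x - ε • d ∈ coneSlice f τ := by
  cases nonempty_fintype ι
  have key : ∀ i, ∃ ε : ℝ, 0 < ε ∧ ∀ t : ℝ, |t| ≤ ε → 0 ≤ f i x + t * f i d := by
    intro i
    rcases (hx.1 i).eq_or_lt with h | h
    · exact ⟨1, one_pos, fun t _ => by rw [hd i h.symm, ← h]; simp⟩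
    · have hp : 0 < |f i d| + 1 := by positivity
      refine ⟨f i x / (|f i d| + 1), by positivity, fun t ht => ?_⟩
      have h1 : |t * f i d| ≤ f i x := by
        rw [abs_mul]
        calc |t| * |f i d| ≤ f i x / (|f i d| + 1) * (|f i d| + 1) := by
              gcongr
              linarith
          _ = f i x := by field_simp
      have := neg_abs_le (t * f i d)
      linarith
  choose ε hε h using key
  obtain ⟨δ, hδ, hδ'⟩ : ∃ δ : ℝ, 0 < δ ∧ ∀ i, δ ≤ ε i := by
    rcases isEmpty_or_nonempty ι with _ | _
    · exact ⟨1, one_pos, fun i => isEmptyElim i⟩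
    · exact ⟨Finset.univ.inf' Finset.univ_nonempty ε, by simpa using hε,
        fun i => Finset.inf'_le _ (Finset.mem_univ i)⟩
  refine ⟨δ, hδ, ⟨fun i => ?_, ?_⟩, ⟨fun i => ?_, ?_⟩⟩
  · simpa using h i δ (by rw [abs_of_pos hδ]; exact hδ' i)
  · simp [hτ, hx.2]
  · have := h i (-δ) (by rw [abs_neg, abs_of_pos hδ]; exact hδ' i)
    simp only [map_sub, map_smul, smul_eq_mul]
    linarith
  · simp [hτ, hx.2]

/-- By compactness `τ` has a positive minimum on the unit vectors of the cone, and its inverse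
bounds the norm at height one. -/
lemma isCompact_coneSlice [FiniteDimensional ℝ E]
    (hpos : ∀ v, (∀ i, 0 ≤ f i v) → v ≠ 0 → 0 < τ v) : IsCompact (coneSlice f τ) := by
  have hf : ∀ g : E →ₗ[ℝ] ℝ, Continuous g := fun g => g.continuous_of_finiteDimensional
  have hcl : IsClosed {v : E | ∀ i, 0 ≤ f i v} := by
    simp only [Set.ofPred_forall]
    exact isClosed_iInter fun i => isClosed_le continuous_const (hf _)
  have hcl' : IsClosed (coneSlice f τ) :=
    hcl.inter (isClosed_eq (hf τ) continuous_const)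
  have hK : IsCompact ({v : E | ∀ i, 0 ≤ f i v} ∩ Metric.sphere 0 1) :=
    (isCompact_sphere 0 1).inter_left hcl
  rcases (coneSlice f τ).eq_empty_or_nonempty with h0 | ⟨v0, hv0⟩
  · rw [h0]; exact isCompact_empty
  have hnorm : ∀ v ∈ coneSlice f τ, 0 < ‖v‖ ∧
      ‖v‖⁻¹ • v ∈ {v : E | ∀ i, 0 ≤ f i v} ∩ Metric.sphere 0 1 := by
    intro v hv
    have hv1 : v ≠ 0 := by
      rintro rfl
      simpa using hv.2
    have hv2 : 0 < ‖v‖ := norm_pos_iff.2 hv1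
    refine ⟨hv2, fun i => ?_, ?_⟩
    · have := hv.1 i
      simp only [map_smul, smul_eq_mul]
      positivity
    · simp [norm_smul, hv2.ne']
  obtain ⟨w, hw, hmin⟩ := hK.exists_isMinOn ⟨_, (hnorm v0 hv0).2⟩ (hf τ).continuousOn
  have hw0 : 0 < τ w := hpos w hw.1 (by
    rintro rfl
    simpa using hw.2)
  refine Metric.isCompact_of_isClosed_isBounded hcl' ?_
  refine (Metric.isBounded_closedBall (x := (0 : E)) (r := (τ w)⁻¹)).subset fun v hv => ?_
  obtain ⟨h1, h2⟩ := hnorm v hv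
  have h3 : τ w ≤ τ (‖v‖⁻¹ • v) := hmin h2
  rw [map_smul, hv.2, smul_eq_mul, mul_one] at h3
  rw [mem_closedBall_zero_iff]
  exact (le_inv_comm₀ hw0 h1).1 h3

/-- An extreme point is determined by its set of tight inequalities: if another point has the same
set, one can move from the first both towards and away from the second. -/
lemma finite_extremePoints_coneSlice [Finite ι] :
    ((coneSlice f τ).extremePoints ℝ).Finite := by
  refine Set.Finite.of_injOn (f := fun v => {i | f i v = 0}) (t := Set.univ)
    (fun _ _ => Set.mem_univ _) ?_ Set.finite_univ
  intro x hx y hy hxy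
  have hxy' : ∀ i, f i x = 0 ↔ f i y = 0 := fun i => Set.ext_iff.1 hxy i
  obtain ⟨ε, hε, h1, h2⟩ := exists_pos_add_smul_mem_coneSlice (d := y - x) hx.1
    (fun i hi => by simp [hi, (hxy' i).1 hi]) (by simp [hx.1.2, hy.1.2])
  have h3 := (mem_extremePoints.1 hx).2 _ h1 _ h2
    ⟨1 / 2, 1 / 2, by norm_num, by norm_num, by norm_num, by module⟩
  have h4 : ε • (y - x) = 0 := by simpa using h3.1
  rcases smul_eq_zero.1 h4 with h | h
  · exact absurd h hε.ne'
  · exact (sub_eq_zero.1 h).symm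

lemma isPolytope_coneSlice [Finite ι] [FiniteDimensional ℝ E]
    (hpos : ∀ v, (∀ i, 0 ≤ f i v) → v ≠ 0 → 0 < τ v) : IsPolytope (coneSlice f τ) := by
  have hfin := finite_extremePoints_coneSlice (f := f) (τ := τ)
  refine ⟨hfin.toFinset, ?_⟩
  rw [hfin.coe_toFinset, ← (hfin.isClosed_convexHull ℝ).closure_eq]
  exact (closure_convexHull_extremePoints (isCompact_coneSlice hpos) convex_coneSlice).symm

/-- Every facet of a polyhedron is cut out by one of its defining inequalities. -/
lemma IsFacet.exists_eq_coneSlice [Finite ι] [FiniteDimensional ℝ E] {F : Set E}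
    (hF : IsFacet (coneSlice f τ) F) : ∃ i, F = {x ∈ coneSlice f τ | f i x = 0} := by
  cases nonempty_fintype ι
  classical
  obtain ⟨hexp, hne, hdim⟩ := hF
  obtain ⟨g, hg⟩ := hexp hne
  have hFQ : F ⊆ coneSlice f τ := by rw [hg]; exact fun x hx => hx.1
  obtain ⟨z, hz⟩ := hne
  have hFconst : ∀ x ∈ F, ∀ y ∈ F, g x = g y := by
    intro x hx y hy
    rw [hg] at hx hy
    exact le_antisymm (hy.2 x hx.1) (hx.2 y hy.1)
  have hmemF : ∀ x ∈ coneSlice f τ, g x = g z → x ∈ F := by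
    intro x hx hxz
    have hz' := hz
    rw [hg] at hz' ⊢
    exact ⟨hx, fun y hy => (hz'.2 y hy).trans hxz.ge⟩
  have hconv : Convex ℝ F := by
    intro x hx y hy a b ha hb hab
    refine hmemF _ (convex_coneSlice (hFQ hx) (hFQ hy) ha hb hab) ?_
    simp only [map_add, map_smul, smul_eq_mul, hFconst x hx z hz, hFconst y hy z hz]
    rw [← add_mul, hab, one_mul]
  -- a point of `F` at which only the inequalities tight on all of `F` are tight
  obtain ⟨x0, hx0, htight⟩ : ∃ x0 ∈ F, ∀ i, f i x0 = 0 → ∀ x ∈ F, f i x = 0 := by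
    have : ∀ s : Finset ι, ∃ x0 ∈ F, ∀ i ∈ s, f i x0 = 0 → ∀ x ∈ F, f i x = 0 := by
      intro s
      induction s using Finset.induction_on with
      | empty => exact ⟨z, hz, by simp⟩
      | insert j s _ ih =>
        obtain ⟨x1, hx1, h1⟩ := ih
        by_cases hj : ∀ x ∈ F, f j x = 0
        · refine ⟨x1, hx1, fun i hi h => ?_⟩
          rcases Finset.mem_insert.1 hi with rfl | hi
          · exact hj
          · exact h1 i hi h
        · push Not at hj
          obtain ⟨y, hy, hyj⟩ := hj
          -- All forms are nonnegative on `F`, so a form that vanishes at the midpoint vanishes at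
          -- both ends.
          refine ⟨(1 / 2 : ℝ) • x1 + (1 / 2 : ℝ) • y,
            hconv hx1 hy (by norm_num) (by norm_num) (by norm_num), fun i hi h => ?_⟩
          have hx1i := (hFQ hx1).1 i
          have hyi := (hFQ hy).1 i
          simp only [map_add, map_smul, smul_eq_mul] at h
          rcases Finset.mem_insert.1 hi with rfl | hi
          · exact absurd (by linarith) hyj
          · exact h1 i hi (by linarith)
    obtain ⟨x0, hx0, h⟩ := this Finset.univ
    exact ⟨x0, hx0, fun i => h i (Finset.mem_univ i)⟩
  -- Otherwise `x0` could be pushed away from every point of the slice, so the functional `g`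
  -- maximized on `F` would be constant and `F` the whole slice, against its dimension.
  obtain ⟨i, hi0, y, hy, hyi⟩ : ∃ i, f i x0 = 0 ∧ ∃ y ∈ coneSlice f τ, f i y ≠ 0 := by
    by_contra! hcon
    have hFeq : F = coneSlice f τ := by
      refine hFQ.antisymm fun y hy => hmemF y hy ?_
      obtain ⟨ε, hε, -, h2⟩ := exists_pos_add_smul_mem_coneSlice (d := y - x0) (hFQ hx0)
        (fun i hi => by simp [hi, hcon i hi y hy]) (by simp [hy.2, (hFQ hx0).2])
      have hx0' := hx0
      rw [hg] at hx0'
      have h3 := hx0'.2 _ h2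
      have h4 := hx0'.2 _ hy
      simp only [map_sub, map_smul, smul_eq_mul] at h3
      have : g y = g x0 := by nlinarith
      rw [this, hFconst x0 hx0 z hz]
    rw [hFeq] at hdim
    omega
  have htF : ∀ x ∈ F, f i x = 0 := htight i hi0
  set G : Set E := {x ∈ coneSlice f τ | f i x = 0} with hG
  have hFG : F ⊆ G := fun x hx => ⟨hFQ hx, htF x hx⟩
  have hGQ : vectorSpan ℝ G ≤ vectorSpan ℝ (coneSlice f τ) := vectorSpan_mono ℝ fun x hx => hx.1
  have hGker : vectorSpan ℝ G ≤ LinearMap.ker (f i) := by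
    rw [vectorSpan_def, Submodule.span_le]
    rintro _ ⟨a, ha, b, hb, rfl⟩
    simp [ha.2, hb.2]
  have hlt : vectorSpan ℝ G < vectorSpan ℝ (coneSlice f τ) := by
    refine lt_of_le_of_ne hGQ fun h => ?_
    have h1 : y - x0 ∈ vectorSpan ℝ (coneSlice f τ) := vsub_mem_vectorSpan ℝ hy (hFQ hx0)
    rw [← h] at h1
    have h2 := hGker h1
    simp only [LinearMap.mem_ker, map_sub, hi0, sub_zero] at h2
    exact hyi h2
  have hle : vectorSpan ℝ F ≤ vectorSpan ℝ G := vectorSpan_mono ℝ hFG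
  -- The span of `F` has codimension one in that of the slice, and the span of `G` is proper; hence
  -- they agree and `g` is constant on `G`.
  have heq : vectorSpan ℝ F = vectorSpan ℝ G := by
    refine Submodule.eq_of_le_of_finrank_le hle ?_
    have := Submodule.finrank_lt_finrank_of_lt hlt
    omega
  have hFker : vectorSpan ℝ F ≤ LinearMap.ker (g : E →ₗ[ℝ] ℝ) := by
    rw [vectorSpan_def, Submodule.span_le]
    rintro _ ⟨a, ha, b, hb, rfl⟩
    simp [hFconst a ha b hb]
  refine ⟨i, hFG.antisymm fun x hx => hmemF x hx.1 ?_⟩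
  have h1 : x - z ∈ vectorSpan ℝ G := vsub_mem_vectorSpan ℝ hx (hFG hz)
  rw [← heq] at h1
  have h2 := hFker h1
  simpa [sub_eq_zero] using h2

lemma numFacets_coneSlice_le [Fintype ι] [FiniteDimensional ℝ E] :
    numFacets (coneSlice f τ) ≤ Fintype.card ι := by
  have h : {F | IsFacet (coneSlice f τ) F} ⊆
      Set.range fun i => {x ∈ coneSlice f τ | f i x = 0} := by
    intro F hF
    obtain ⟨i, hi⟩ := IsFacet.exists_eq_coneSlice hF
    exact ⟨i, hi.symm⟩
  calc numFacets (coneSlice f τ) ≤ (Set.range fun i => {x ∈ coneSlice f τ | f i x = 0}).encard :=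
        Set.encard_le_encard h
    _ ≤ (Set.univ : Set ι).encard := by
        rw [← Set.image_univ]; exact Set.encard_image_le _ _
    _ = Fintype.card ι := by simp

end Slice

/-! ### Lifts of cones, and cones over planar sets -/

/-- `C` is the linear image of a polyhedral cone that is defined by at most `r` inequalities and
meets the kernel of the linear map only at `0`. -/
def HasConeLift {E : Type*} [AddCommGroup E] [Module ℝ E] (C : Set E) (r : ℕ) : Prop :=
  ∃ (V : Type) (_ : AddCommGroup V) (_ : Module ℝ V) (_ : FiniteDimensional ℝ V)
    (ι : Type) (_ : Fintype ι) (f : ι → V →ₗ[ℝ] ℝ) (Φ : V →ₗ[ℝ] E),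
    Fintype.card ι ≤ r ∧ (∀ v, (∀ i, 0 ≤ f i v) → Φ v = 0 → v = 0) ∧
      Φ '' {v | ∀ i, 0 ≤ f i v} = C

lemma HasConeLift.map {E F : Type*} [AddCommGroup E] [Module ℝ E] [AddCommGroup F] [Module ℝ F]
    {C : Set E} {r : ℕ} (h : HasConeLift C r) (e : E ≃ₗ[ℝ] F) : HasConeLift (e '' C) r := by
  obtain ⟨V, _, _, _, ι, _, f, Φ, hr, hker, him⟩ := h
  refine ⟨V, _, _, ‹_›, ι, _, f, e.toLinearMap ∘ₗ Φ, hr, fun v hv h0 => hker v hv ?_, ?_⟩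
  · simpa using h0
  · rw [← him, Set.image_image]
    rfl

/-- Sums of lifted cones in a half-space. -/
lemma HasConeLift.add {E : Type*} [AddCommGroup E] [Module ℝ E] {C D : Set E} {r r' : ℕ}
    (hC : HasConeLift C r) (hD : HasConeLift D r') (τ : E →ₗ[ℝ] ℝ)
    (hτC : ∀ z ∈ C, z ≠ 0 → 0 < τ z) (hτD : ∀ z ∈ D, z ≠ 0 → 0 < τ z) :
    HasConeLift {z | ∃ x ∈ C, ∃ y ∈ D, z = x + y} (r + r') := by
  obtain ⟨V, _, _, _, ι, _, f, Φ, hr, hker, him⟩ := hC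
  obtain ⟨W, _, _, _, κ, _, g, Ψ, hr', hker', him'⟩ := hD
  refine ⟨V × W, inferInstance, inferInstance, inferInstance, ι ⊕ κ, inferInstance,
    Sum.elim (fun i => f i ∘ₗ LinearMap.fst ℝ V W) (fun k => g k ∘ₗ LinearMap.snd ℝ V W),
    Φ.coprod Ψ, ?_, ?_, ?_⟩
  · rw [Fintype.card_sum]; omega
  · rintro ⟨v, w⟩ h h0
    have hv : ∀ i, 0 ≤ f i v := fun i => h (Sum.inl i)
    have hw : ∀ i, 0 ≤ g i w := fun i => h (Sum.inr i)
    have hvC : Φ v ∈ C := him ▸ ⟨v, hv, rfl⟩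
    have hwD : Ψ w ∈ D := him' ▸ ⟨w, hw, rfl⟩
    have h1 : Φ v + Ψ w = 0 := by simpa using h0
    have h2 : τ (Φ v) + τ (Ψ w) = 0 := by rw [← map_add, h1, map_zero]
    have h3 : Φ v = 0 := by
      by_contra hne
      have a1 := hτC _ hvC hne
      by_cases hne' : Ψ w = 0
      · rw [hne', map_zero] at h2; linarith
      · have a2 := hτD _ hwD hne'
        linarith
    have h4 : Ψ w = 0 := by rwa [h3, zero_add] at h1
    rw [hker v hv h3, hker' w hw h4]
    rfl
  · ext z
    constructor
    · rintro ⟨⟨v, w⟩, h, rfl⟩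
      refine ⟨Φ v, him ▸ ⟨v, fun i => h (Sum.inl i), rfl⟩, Ψ w,
        him' ▸ ⟨w, fun i => h (Sum.inr i), rfl⟩, by simp⟩
    · rintro ⟨x, hx, y, hy, rfl⟩
      rw [← him] at hx
      rw [← him'] at hy
      obtain ⟨v, hv, rfl⟩ := hx
      obtain ⟨w, hw, rfl⟩ := hy
      refine ⟨(v, w), ?_, by simp⟩
      rintro (i | i)
      · exact hv i
      · exact hw i

/-- The cone over a planar set placed at height one. -/
def coneOver (s : Set (Fin 2 → ℝ)) : Set (ℝ × (Fin 2 → ℝ)) :=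
  PointedCone.hull ℝ ((fun p => ((1 : ℝ), p)) '' s)

lemma pair_mem_coneOver {s : Set (Fin 2 → ℝ)} {p : Fin 2 → ℝ} (hp : p ∈ s) :
    ((1 : ℝ), p) ∈ coneOver s :=
  Submodule.subset_span ⟨p, hp, rfl⟩

lemma coneOver_mono {s t : Set (Fin 2 → ℝ)} (h : s ⊆ t) : coneOver s ⊆ coneOver t :=
  Submodule.span_mono (Set.image_mono h)

lemma add_mem_coneOver {s : Set (Fin 2 → ℝ)} {x y : ℝ × (Fin 2 → ℝ)}
    (hx : x ∈ coneOver s) (hy : y ∈ coneOver s) : x + y ∈ coneOver s :=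
  Submodule.add_mem _ hx hy

lemma smul_mem_coneOver {s : Set (Fin 2 → ℝ)} {x : ℝ × (Fin 2 → ℝ)} {c : ℝ} (hc : 0 ≤ c)
    (hx : x ∈ coneOver s) : c • x ∈ coneOver s :=
  Submodule.smul_mem (PointedCone.hull ℝ ((fun p => ((1 : ℝ), p)) '' s)) ⟨c, hc⟩ hx

lemma mem_coneOver_cases {s : Set (Fin 2 → ℝ)} {z : ℝ × (Fin 2 → ℝ)} (hz : z ∈ coneOver s) :
    z = 0 ∨ 0 < z.1 ∧ z.1⁻¹ • z.2 ∈ convexHull ℝ s := by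
  refine Submodule.span_induction (p := fun z _ => z = 0 ∨ 0 < z.1 ∧ z.1⁻¹ • z.2 ∈ convexHull ℝ s)
    ?_ (Or.inl rfl) ?_ ?_ hz
  · rintro _ ⟨p, hp, rfl⟩
    right
    simpa using subset_convexHull ℝ s hp
  · rintro ⟨a, p⟩ ⟨b, q⟩ - - (h | ⟨h1, h2⟩) (h' | ⟨h1', h2'⟩)
    · left; rw [h, h', add_zero]
    · right; rw [h, zero_add]; exact ⟨h1', h2'⟩
    · right; rw [h', add_zero]; exact ⟨h1, h2⟩
    · right
      dsimp only [Prod.mk_add_mk] at h1 h2 h1' h2' ⊢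
      have hab : 0 < a + b := by positivity
      refine ⟨hab, ?_⟩
      have := convex_convexHull ℝ s h2 h2' (a := a / (a + b)) (b := b / (a + b))
        (by positivity) (by positivity) (by field_simp)
      convert this using 1
      rw [smul_smul, smul_smul, smul_add]
      congr 2 <;> field_simp
  · rintro ⟨c, hc⟩ ⟨a, p⟩ - (h | ⟨h1, h2⟩)
    · left; rw [h, smul_zero]
    · have h3 : (⟨c, hc⟩ : {c : ℝ // 0 ≤ c}) • ((a, p) : ℝ × (Fin 2 → ℝ)) = (c * a, c • p) := rfl
      rw [h3]
      rcases hc.eq_or_lt with h0 | h0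
      · left; simp [← h0]
      · right
        dsimp only at h1 h2 ⊢
        refine ⟨by positivity, ?_⟩
        convert h2 using 1
        rw [smul_smul]
        congr 1
        field_simp

/-- The extension is the part of the lifting cone that lies above height one. The kernel condition
makes the height positive off the origin, hence this slice is bounded. -/
lemma exists_isExtension_of_hasConeLift {s : Set (Fin 2 → ℝ)} {r : ℕ}
    (h : HasConeLift (coneOver s) r) :
    ∃ (d : ℕ) (Q : Set (Fin d → ℝ)) (π : (Fin d → ℝ) →ₗ[ℝ] (Fin 2 → ℝ)),
      IsExtension (convexHull ℝ s) Q π ∧ numFacets Q ≤ (r : ℕ∞) := by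
  obtain ⟨V, _, _, _, ι, _, f, Φ, hr, hker, him⟩ := h
  let e : (Fin (Module.finrank ℝ V) → ℝ) ≃ₗ[ℝ] V := (Module.finBasis ℝ V).equivFun.symm
  let f' : ι → (Fin (Module.finrank ℝ V) → ℝ) →ₗ[ℝ] ℝ := fun i => f i ∘ₗ e.toLinearMap
  let Φ' := Φ ∘ₗ e.toLinearMap
  let τ := LinearMap.fst ℝ ℝ (Fin 2 → ℝ) ∘ₗ Φ'
  have hmem : ∀ v, (∀ i, 0 ≤ f' i v) → Φ' v ∈ coneOver s := fun v hv => him ▸ ⟨e v, hv, rfl⟩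
  have hpos : ∀ v, (∀ i, 0 ≤ f' i v) → v ≠ 0 → 0 < τ v := by
    intro v hv hne
    rcases mem_coneOver_cases (hmem v hv) with h0 | ⟨h1, -⟩
    · have := hker (e v) hv h0
      simp only [map_eq_zero_iff e e.injective] at this
      exact absurd this hne
    · exact h1
  refine ⟨_, coneSlice f' τ, LinearMap.snd ℝ ℝ (Fin 2 → ℝ) ∘ₗ Φ',
    ⟨isPolytope_coneSlice hpos, ?_⟩, numFacets_coneSlice_le.trans (by exact_mod_cast hr)⟩
  apply subset_antisymm
  · rintro _ ⟨v, hv, rfl⟩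
    have h1 : (Φ' v).1 = 1 := hv.2
    rcases mem_coneOver_cases (hmem v hv.1) with h0 | ⟨-, h2⟩
    · rw [h0] at h1; simp at h1
    · rw [h1, inv_one, one_smul] at h2
      exact h2
  · refine convexHull_min ?_ (convex_coneSlice.linear_image _)
    intro p hp
    have h1 := pair_mem_coneOver hp
    rw [← him] at h1
    obtain ⟨v, hv, hvp⟩ := h1
    refine ⟨e.symm v, ⟨fun i => ?_, ?_⟩, ?_⟩
    · simpa [f'] using hv i
    · simp [τ, Φ', hvp]
    · simp [Φ', hvp]

/-- The trivial lift, with one inequality for each generator. -/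
lemma hasConeLift_coneOver_finset (s : Finset (Fin 2 → ℝ)) :
    HasConeLift (coneOver (s : Set (Fin 2 → ℝ))) s.card := by
  let w : (Fin 2 → ℝ) → ℝ × (Fin 2 → ℝ) := fun p => (1, p)
  let Φ : (Fin s.card → ℝ) →ₗ[ℝ] ℝ × (Fin 2 → ℝ) :=
    Fintype.linearCombination ℝ (fun i => w (s.equivFin.symm i))
  refine ⟨Fin s.card → ℝ, inferInstance, inferInstance, inferInstance, Fin s.card, inferInstance,
    fun i => LinearMap.proj i, Φ, by simp, ?_, ?_⟩
  · intro v hv h0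
    have h1 : (Φ v).1 = 0 := by rw [h0]; rfl
    have h2 : (Φ v).1 = ∑ i, v i := by
      simp [Φ, w, Fintype.linearCombination_apply, Prod.fst_sum]
    have h3 : ∀ i ∈ Finset.univ, 0 ≤ v i := fun i _ => hv i
    rw [h2, Finset.sum_eq_zero_iff_of_nonneg h3] at h1
    ext i
    exact h1 i (Finset.mem_univ i)
  · apply subset_antisymm
    · rintro _ ⟨v, hv, rfl⟩
      rw [Fintype.linearCombination_apply]
      refine Submodule.sum_mem (PointedCone.hull ℝ (w '' (s : Set (Fin 2 → ℝ)))) fun i _ => ?_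
      exact smul_mem_coneOver (hv i) (pair_mem_coneOver (s.equivFin.symm i).2)
    · intro z hz
      refine Submodule.span_induction (p := fun z _ => z ∈ Φ '' {v | ∀ i, 0 ≤ v i}) ?_ ?_ ?_ ?_ hz
      · rintro _ ⟨p, hp, rfl⟩
        refine ⟨Pi.single (s.equivFin ⟨p, hp⟩) 1, fun i => ?_, ?_⟩
        · by_cases h : i = s.equivFin ⟨p, hp⟩
          · subst h; simp
          · simp [Pi.single_eq_of_ne h]
        · simp [Φ, Fintype.linearCombination_apply_single, w]
      · exact ⟨0, fun i => le_rfl, map_zero _⟩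
      · rintro _ _ - - ⟨v, hv, rfl⟩ ⟨v', hv', rfl⟩
        exact ⟨v + v', fun i => add_nonneg (hv i) (hv' i), map_add _ _ _⟩
      · rintro ⟨c, hc⟩ _ - ⟨v, hv, rfl⟩
        exact ⟨c • v, fun i => mul_nonneg hc (hv i), map_smul _ _ _⟩

lemma HasConeLift.exists_pointedCone {E : Type*} [AddCommGroup E] [Module ℝ E] {C : Set E} {r : ℕ}
    (h : HasConeLift C r) : ∃ K : PointedCone ℝ E, (K : Set E) = C := by
  obtain ⟨V, _, _, _, ι, _, f, Φ, -, -, rfl⟩ := h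
  have hadd : ∀ a b, a ∈ Φ '' {v | ∀ i, 0 ≤ f i v} → b ∈ Φ '' {v | ∀ i, 0 ≤ f i v} →
      a + b ∈ Φ '' {v | ∀ i, 0 ≤ f i v} := by
    rintro _ _ ⟨v, hv, rfl⟩ ⟨w, hw, rfl⟩
    exact ⟨v + w, fun i => by simpa using add_nonneg (hv i) (hw i), map_add _ _ _⟩
  have hzero : (0 : E) ∈ Φ '' {v | ∀ i, 0 ≤ f i v} := ⟨0, fun i => by simp, map_zero _⟩
  have hsmul : ∀ (c : ℝ) (a : E), 0 ≤ c → a ∈ Φ '' {v | ∀ i, 0 ≤ f i v} →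
      c • a ∈ Φ '' {v | ∀ i, 0 ≤ f i v} := by
    rintro c _ hc ⟨v, hv, rfl⟩
    exact ⟨c • v, fun i => by simpa using mul_nonneg hc (hv i), map_smul _ _ _⟩
  exact ⟨⟨⟨⟨_, fun {a b} => hadd a b⟩, hzero⟩, fun c a ha => hsmul c a c.2 ha⟩, rfl⟩

/-! ### Lacunary chains: edges, apices and the hull -/

/-- The points `(x i, r i * x i)`, `i ≤ n`, of the positive quadrant, whose abscissae `x` and
slopes `r` as seen from the origin at least double at each step. -/
structure IsLacunary (n : ℕ) (x r : ℕ → ℝ) : Prop where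
  x_pos : ∀ i, i ≤ n → 0 < x i
  r_pos : ∀ i, i ≤ n → 0 < r i
  x_two : ∀ i j, i < j → j ≤ n → 2 * x i ≤ x j
  r_two : ∀ i j, i < j → j ≤ n → 2 * r i ≤ r j

namespace IsLacunary

/-- The homogenized points of the chain. -/
def pt (x r : ℕ → ℝ) (i : ℕ) : ℝ × ℝ × ℝ := (1, x i, r i * x i)

/-- The slope of the edge from the `i`-th to the next point of the chain. -/
noncomputable def slope (x r : ℕ → ℝ) (i : ℕ) : ℝ :=
  (r (i + 1) * x (i + 1) - r i * x i) / (x (i + 1) - x i)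

/-- The linear form that vanishes on the `i`-th edge of the chain. -/
noncomputable def edge (x r : ℕ → ℝ) (i : ℕ) : ℝ × ℝ × ℝ →ₗ[ℝ] ℝ :=
  LinearMap.snd ℝ ℝ ℝ ∘ₗ LinearMap.snd ℝ ℝ (ℝ × ℝ)
    - slope x r i • (LinearMap.fst ℝ ℝ ℝ ∘ₗ LinearMap.snd ℝ ℝ (ℝ × ℝ))
    + (slope x r i * x i - r i * x i) • LinearMap.fst ℝ ℝ (ℝ × ℝ)

lemma edge_apply (x r : ℕ → ℝ) (i : ℕ) (t X Y : ℝ) :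
    edge x r i (t, X, Y) = Y - slope x r i * X + (slope x r i * x i - r i * x i) * t := by
  simp [edge]

lemma edge_pt (x r : ℕ → ℝ) (i j : ℕ) :
    edge x r i (pt x r j) = r j * x j - slope x r i * x j + (slope x r i * x i - r i * x i) := by
  rw [pt, edge_apply, mul_one]

variable {n : ℕ} {x r : ℕ → ℝ}

lemma x_lt (h : IsLacunary n x r) {i j : ℕ} (hij : i < j) (hj : j ≤ n) : x i < x j := by
  have := h.x_two i j hij hj
  have := h.x_pos i (by omega)
  linarith

lemma x_le (h : IsLacunary n x r) {i j : ℕ} (hij : i ≤ j) (hj : j ≤ n) : x i ≤ x j := by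
  rcases hij.eq_or_lt with rfl | hlt
  · exact le_rfl
  · exact (h.x_lt hlt hj).le

lemma r_lt (h : IsLacunary n x r) {i j : ℕ} (hij : i < j) (hj : j ≤ n) : r i < r j := by
  have := h.r_two i j hij hj
  have := h.r_pos i (by omega)
  linarith

lemma r_le (h : IsLacunary n x r) {i j : ℕ} (hij : i ≤ j) (hj : j ≤ n) : r i ≤ r j := by
  rcases hij.eq_or_lt with rfl | hlt
  · exact le_rfl
  · exact (h.r_lt hlt hj).le

/-- With `slope_le` this pins the slope between `r (i + 1)` and twice that number. Most later
estimates use only these bounds and the doubling. -/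
lemma le_slope (h : IsLacunary n x r) {i : ℕ} (hi : i < n) : r (i + 1) ≤ slope x r i := by
  have hx := h.x_lt (Nat.lt_succ_self i) hi
  have hr := h.r_lt (Nat.lt_succ_self i) hi
  have hx0 := h.x_pos i hi.le
  simp only [Nat.succ_eq_add_one] at hx hr
  rw [slope, le_div_iff₀ (by linarith)]
  nlinarith

lemma slope_le (h : IsLacunary n x r) {i : ℕ} (hi : i < n) : slope x r i ≤ 2 * r (i + 1) := by
  have hx := h.x_lt (Nat.lt_succ_self i) hi
  have hx2 := h.x_two i (i + 1) (Nat.lt_succ_self i) hi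
  have hr0 := h.r_pos i hi.le
  have hr1 := h.r_pos (i + 1) hi
  have hx0 := h.x_pos i hi.le
  simp only [Nat.succ_eq_add_one] at hx
  rw [slope, div_le_iff₀ (by linarith)]
  nlinarith [mul_pos hr0 hx0]

lemma slope_lt (h : IsLacunary n x r) {i k : ℕ} (hik : i + 2 ≤ k) (hk : k < n) :
    slope x r i < slope x r k := by
  have h1 := h.slope_le (i := i) (by omega)
  have h2 := h.le_slope hk
  have h3 := h.r_two (i + 1) (i + 2) (by omega) (by omega)
  have h4 := h.r_lt (i := i + 2) (j := k + 1) (by omega) (by omega)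
  linarith

lemma slope_mono (h : IsLacunary n x r) {i k : ℕ} (hik : i < k) (hk : k < n) :
    slope x r i ≤ slope x r k := by
  have h1 := h.slope_le (i := i) (by omega)
  have h2 := h.le_slope hk
  have h3 := h.r_two (i + 1) (k + 1) (by omega) (by omega)
  linarith

lemma edge_pt_self (x r : ℕ → ℝ) (i : ℕ) : edge x r i (pt x r i) = 0 := by
  rw [edge_pt]; ring

lemma edge_pt_succ (h : IsLacunary n x r) {i : ℕ} (hi : i < n) :
    edge x r i (pt x r (i + 1)) = 0 := by
  have hx := h.x_lt (Nat.lt_succ_self i) hi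
  simp only [Nat.succ_eq_add_one] at hx
  have : slope x r i * (x (i + 1) - x i) = r (i + 1) * x (i + 1) - r i * x i :=
    div_mul_cancel₀ _ (by linarith)
  rw [edge_pt]
  linarith

/-- The negative of the intercept of an edge is positive. -/
lemma intercept_pos (h : IsLacunary n x r) {i : ℕ} (hi : i < n) :
    0 < slope x r i * x i - r i * x i := by
  have h1 := h.le_slope hi
  have h2 := h.r_lt (i := i) (j := i + 1) (by omega) hi
  have h3 := h.x_pos i hi.le
  nlinarith

/-- The edge form at the `j`-th point exceeds the negated intercept by `(r j - slope x r i) * x j`,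
so only `r j` and the slope have to be compared. The same holds for `edge_pt_le_intercept`. -/
lemma intercept_le_edge_pt (h : IsLacunary n x r) {i j : ℕ} (hij : i + 2 ≤ j) (hj : j ≤ n) :
    slope x r i * x i - r i * x i ≤ edge x r i (pt x r j) := by
  have h1 := h.slope_le (i := i) (by omega)
  have h2 := h.r_two (i + 1) j (by omega) hj
  have h3 := h.x_pos j hj
  rw [edge_pt]
  nlinarith

lemma edge_pt_le_intercept (h : IsLacunary n x r) {i j : ℕ} (hij : j ≤ i) (hi : i < n) :
    edge x r i (pt x r j) ≤ slope x r i * x i - r i * x i := by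
  have h1 := h.le_slope hi
  have h2 := h.r_le (i := j) (j := i + 1) (by omega) hi
  have h3 := h.x_pos j (by omega)
  rw [edge_pt]
  nlinarith

lemma edge_pt_pos (h : IsLacunary n x r) {i j : ℕ} (hi : i < n) (hj : j ≤ n) (h1 : j ≠ i)
    (h2 : j ≠ i + 1) : 0 < edge x r i (pt x r j) := by
  rcases lt_or_gt_of_ne h1 with hlt | hgt
  · have a1 := h.le_slope hi
    have a2 := h.r_two i (i + 1) (by omega) hi
    have a3 := h.x_two j i hlt hi.le
    have a4 := h.x_pos j hj
    have a5 := h.r_pos j hj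
    have a6 := h.r_pos i hi.le
    have a7 := h.x_pos i hi.le
    rw [edge_pt]
    -- The slope is at least `2 * r i` and `x i - x j` at least `x i / 2`, so the form is at least
    -- `r j * x j`.
    have b1 : 2 * r i * (x i / 2) ≤ slope x r i * (x i - x j) := by
      apply mul_le_mul <;> linarith
    have b2 := mul_pos a5 a4
    nlinarith
  · exact (h.intercept_pos hi).trans_le (h.intercept_le_edge_pt (by omega) hj)

lemma edge_pt_nonneg (h : IsLacunary n x r) {i j : ℕ} (hi : i < n) (hj : j ≤ n) :
    0 ≤ edge x r i (pt x r j) := by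
  by_cases h1 : j = i
  · rw [h1, edge_pt_self]
  by_cases h2 : j = i + 1
  · rw [h2, h.edge_pt_succ hi]
  exact (h.edge_pt_pos hi hj h1 h2).le

/-- Between the points of two edges, the later edge is the lower one. -/
lemma edge_le_edge_of_le (h : IsLacunary n x r) {i k : ℕ} (hik : i < k) (hk : k < n) {X : ℝ}
    (Y : ℝ) (hX : x k ≤ X) : edge x r k (1, X, Y) ≤ edge x r i (1, X, Y) := by
  have h1 := h.slope_mono hik hk
  have h2 := h.edge_pt_nonneg (i := i) (j := k) (by omega) hk.le
  rw [edge_pt] at h2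
  rw [edge_apply, edge_apply]
  nlinarith

lemma edge_le_edge_of_ge (h : IsLacunary n x r) {i k : ℕ} (hik : i < k) (hk : k < n) {X : ℝ}
    (Y : ℝ) (hX : X ≤ x (i + 1)) : edge x r i (1, X, Y) ≤ edge x r k (1, X, Y) := by
  have h1 := h.slope_mono hik hk
  have h2 := h.edge_pt_nonneg (i := k) (j := i + 1) hk (by omega)
  have h3 := h.edge_pt_succ (i := i) (by omega)
  rw [edge_pt] at h2 h3
  rw [edge_apply, edge_apply]
  nlinarith

/-- The slacks of two edges, one on either side of the `g`-th point, form a totally positive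
pair with respect to this point. -/
lemma edge_mul_edge_le (h : IsLacunary n x r) {i g l j : ℕ} (hig : i + 2 ≤ g) (hgl : g < l)
    (hl : l < n) (hj : j ≤ n) :
    (j ≤ g → edge x r i (pt x r j) * edge x r l (pt x r g) ≤
        edge x r i (pt x r g) * edge x r l (pt x r j)) ∧
      (g ≤ j → edge x r i (pt x r g) * edge x r l (pt x r j) ≤
        edge x r i (pt x r j) * edge x r l (pt x r g)) := by
  set A := edge x r i (pt x r g) with hA
  set B := edge x r l (pt x r g) with hB
  have hA0 : 0 < A := h.edge_pt_pos (by omega) (by omega) (by omega) (by omega)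
  have hdA : slope x r i * x i - r i * x i ≤ A := h.intercept_le_edge_pt hig (by omega)
  have hBd : B ≤ slope x r l * x l - r l * x l := h.edge_pt_le_intercept (by omega) hl
  have hd0 := h.intercept_pos (i := i) (by omega)
  -- The number `r g * x g` separates the two values: it is above `A`, and below `B` because `x` and
  -- `r` double.
  have hAB : A ≤ B := by
    have h1 := h.slope_le (i := i) (by omega)
    have h2 := h.le_slope hl
    have h3 := h.r_two l (l + 1) (by omega) (by omega)
    have h4 := h.x_two g l hgl (by omega)
    have h5 := h.x_pos g (by omega)
    have h6 := h.r_pos l (by omega)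
    have h7 := h.x_lt (i := i) (j := g) (by omega) (by omega)
    have h8 := h.r_pos i (by omega)
    have h9 := h.x_pos i (by omega)
    have h10 := h.x_pos l (by omega)
    have h11 := h.le_slope (i := i) (by omega)
    have h12 := h.r_pos (i + 1) (by omega)
    rw [hA, hB, edge_pt, edge_pt]
    have b1 : 2 * r l * (x l / 2) ≤ slope x r l * (x l - x g) := by
      apply mul_le_mul <;> linarith
    have b2 := mul_pos h8 h9
    have b3 : 0 ≤ slope x r i * (x g - x i) := mul_nonneg (by linarith) (by linarith)
    nlinarith
  have hA' := hA
  have hB' := hB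
  rw [edge_pt] at hA' hB'
  rw [edge_pt, edge_pt]
  set a := slope x r i
  set b := slope x r l
  set d := a * x i - r i * x i
  set e := b * x l - r l * x l
  have hxg := h.x_pos g (by omega)
  have hxj := h.x_pos j hj
  have hde : d * B ≤ A * e := by nlinarith
  -- the affine function `B * edge i - A * edge l`, evaluated at `j`, times `x g`
  have key : x g * ((r j * x j - a * x j + d) * B - A * (r j * x j - b * x j + e)) =
      (x g - x j) * (d * B - A * e) + (B - A) * ((r j - r g) * x j * x g) := by
    linear_combination x j * A * hB' - x j * B * hA'
  -- As `d * B ≤ A * e` and `A ≤ B`, and as `x` and `r` increase, both summands on the right are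
  -- nonpositive for `j ≤ g` and nonnegative for `g ≤ j`.
  constructor
  · intro hjg
    have h1 := h.x_le hjg (by omega)
    have h2 := h.r_le hjg (by omega)
    have h3 : (x g - x j) * (d * B - A * e) ≤ 0 :=
      mul_nonpos_of_nonneg_of_nonpos (by linarith) (by linarith)
    have h4 : (B - A) * ((r j - r g) * x j * x g) ≤ 0 := by
      apply mul_nonpos_of_nonneg_of_nonpos (by linarith)
      rw [mul_assoc]
      exact mul_nonpos_of_nonpos_of_nonneg (by linarith) (by positivity)
    by_contra hcon
    have := mul_pos hxg (sub_pos.2 (not_le.1 hcon))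
    linarith
  · intro hjg
    have h1 := h.x_le hjg hj
    have h2 := h.r_le hjg hj
    have h3 : 0 ≤ (x g - x j) * (d * B - A * e) :=
      mul_nonneg_of_nonpos_of_nonpos (by linarith) (by linarith)
    have h4 : 0 ≤ (B - A) * ((r j - r g) * x j * x g) := by
      apply mul_nonneg (by linarith)
      rw [mul_assoc]
      exact mul_nonneg (by linarith) (by positivity)
    by_contra hcon
    have := mul_pos hxg (sub_pos.2 (not_le.1 hcon))
    linarith

/-- The intersection point of the lines through the `i`-th and the `k`-th edge. -/
noncomputable def apex (x r : ℕ → ℝ) (i k : ℕ) : ℝ × ℝ × ℝ :=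
  let X := ((slope x r k * x k - r k * x k) - (slope x r i * x i - r i * x i)) /
    (slope x r k - slope x r i)
  (1, X, slope x r i * X - (slope x r i * x i - r i * x i))

lemma edge_apex_left (x r : ℕ → ℝ) (i k : ℕ) : edge x r i (apex x r i k) = 0 := by
  rw [apex, edge_apply]; ring

lemma edge_apex_right (h : IsLacunary n x r) {i k : ℕ} (hik : i + 2 ≤ k) (hk : k < n) :
    edge x r k (apex x r i k) = 0 := by
  have h1 := h.slope_lt hik hk
  have h2 : slope x r k - slope x r i ≠ 0 := by linarith
  rw [apex, edge_apply]
  field_simp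
  ring

lemma x_le_apex (h : IsLacunary n x r) {i k : ℕ} (hik : i + 2 ≤ k) (hk : k < n) :
    x (i + 1) ≤ (apex x r i k).2.1 := by
  have h1 := h.slope_lt hik hk
  have h2 := h.edge_le_edge_of_ge (i := i) (k := k) (by omega) hk 0 le_rfl
  rw [edge_apply, edge_apply] at h2
  rw [apex]
  dsimp only
  rw [le_div_iff₀ (by linarith)]
  linarith

lemma apex_le_x (h : IsLacunary n x r) {i k : ℕ} (hik : i + 2 ≤ k) (hk : k < n) :
    (apex x r i k).2.1 ≤ x k := by
  have h1 := h.slope_lt hik hk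
  have h2 := h.edge_le_edge_of_le (i := i) (k := k) (by omega) hk 0 le_rfl
  rw [edge_apply, edge_apply] at h2
  rw [apex]
  dsimp only
  rw [div_le_iff₀ (by linarith)]
  linarith

/-- The edges `i` and `k` vanish at the apex, whose abscissa lies between `x (i + 1)` and `x k`.
There an edge further out lies below the nearer of these two lines. -/
lemma edge_apex_nonneg (h : IsLacunary n x r) {i k e : ℕ} (hik : i + 2 ≤ k) (hk : k < n)
    (he : e < n) (hout : e ≤ i ∨ k ≤ e) : 0 ≤ edge x r e (apex x r i k) := by
  have hl := h.x_le_apex hik hk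
  have hr := h.apex_le_x hik hk
  have h0 := edge_apex_left x r i k
  have h1 := h.edge_apex_right hik hk
  have h2 : apex x r i k = (1, (apex x r i k).2.1, (apex x r i k).2.2) := rfl
  rcases hout with h3 | h3
  · rcases h3.eq_or_lt with rfl | h3
    · exact h0.ge
    · rw [← h0, h2]
      exact h.edge_le_edge_of_le h3 (by omega) _ ((h.x_le (Nat.le_succ i) (by omega)).trans hl)
  · rcases h3.eq_or_lt with rfl | h3
    · exact h1.ge
    · rw [← h1, h2]
      exact h.edge_le_edge_of_ge h3 he _ (hr.trans (h.x_le (Nat.le_succ k) (by omega)))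

/-- An inner edge passes on or above the apex: it is compared with edge `i` if the apex is to the
right of `x e`, and with edge `k` otherwise. -/
lemma edge_apex_nonpos (h : IsLacunary n x r) {i k e : ℕ} (hk : k < n) (hie : i < e)
    (hek : e < k) : edge x r e (apex x r i k) ≤ 0 := by
  have hik : i + 2 ≤ k := by omega
  have hl := h.x_le_apex hik hk
  have hr := h.apex_le_x hik hk
  have h2 : apex x r i k = (1, (apex x r i k).2.1, (apex x r i k).2.2) := rfl
  rcases le_total (x e) (apex x r i k).2.1 with h3 | h3
  · rw [← edge_apex_left x r i k, h2]
    exact h.edge_le_edge_of_le hie (by omega) _ h3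
  · rw [← h.edge_apex_right hik hk, h2]
    exact h.edge_le_edge_of_ge hek hk _ (h3.trans (h.x_le (Nat.le_succ e) (by omega)))

/-- The points between two edges lie in the triangle spanned by the ends of the block and the
apex. -/
lemma exists_pt_eq (h : IsLacunary n x r) {i j k : ℕ} (hik : i + 2 ≤ k) (hk : k < n)
    (hij : i + 1 ≤ j) (hjk : j ≤ k) :
    ∃ u v w : ℝ, 0 ≤ u ∧ 0 ≤ v ∧ 0 ≤ w ∧
      pt x r j = u • pt x r (i + 1) + v • pt x r k + w • apex x r i k := by
  have hA : 0 < edge x r k (pt x r (i + 1)) :=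
    h.edge_pt_pos hk (by omega) (by omega) (by omega)
  have hB : 0 < edge x r i (pt x r k) :=
    h.edge_pt_pos (by omega) (by omega) (by omega) (by omega)
  have hAj := h.edge_pt_nonneg (i := k) (j := j) hk (by omega)
  have hBj := h.edge_pt_nonneg (i := i) (j := j) (by omega) (by omega)
  -- These are barycentric coordinates: edge `k` vanishes at the `k`-th point and the apex, edge `i`
  -- at the `(i + 1)`-th point and the apex.
  set u := edge x r k (pt x r j) / edge x r k (pt x r (i + 1)) with hu
  set v := edge x r i (pt x r j) / edge x r i (pt x r k) with hv
  have huA : u * edge x r k (pt x r (i + 1)) = edge x r k (pt x r j) := div_mul_cancel₀ _ hA.ne'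
  have hvB : v * edge x r i (pt x r k) = edge x r i (pt x r j) := div_mul_cancel₀ _ hB.ne'
  -- If `x j` divides the block's range in the ratio `w : 1 - w`, convexity of the chain gives `u ≤
  -- 1 - w` and `v ≤ w`.
  have huv : u + v ≤ 1 := by
    have hx1 := h.x_le hij (by omega)
    have hx2 := h.x_le hjk (by omega)
    have hx3 := h.x_lt (i := i + 1) (j := k) (by omega) (by omega)
    set w := (x j - x (i + 1)) / (x k - x (i + 1)) with hw
    have hw' : w * (x k - x (i + 1)) = x j - x (i + 1) := div_mul_cancel₀ _ (by linarith)
    have hw0 : 0 ≤ w := div_nonneg (by linarith) (by linarith)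
    have hw1 : w ≤ 1 := by rw [hw, div_le_one (by linarith)]; linarith
    have hxj : x j = (1 - w) * x (i + 1) + w * x k := by linarith
    have c1 := mul_nonneg (sub_nonneg.2 hw1)
      (h.edge_pt_nonneg (i := j) (j := i + 1) (by omega) (by omega))
    have c2 := mul_nonneg hw0 (h.edge_pt_nonneg (i := j) (j := k) (by omega) (by omega))
    have hchord : r j * x j ≤ (1 - w) * (r (i + 1) * x (i + 1)) + w * (r k * x k) := by
      rw [edge_pt] at c1 c2
      have := edge_pt_self x r j
      have e1 : slope x r j * x j = slope x r j * ((1 - w) * x (i + 1) + w * x k) := by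
        rw [← hxj]
      nlinarith
    have hu1 : u ≤ 1 - w := by
      rw [hu, div_le_iff₀ hA]
      have := edge_pt_self x r k
      rw [edge_pt] at this ⊢
      rw [edge_pt]
      have e1 : slope x r k * x j = slope x r k * ((1 - w) * x (i + 1) + w * x k) := by
        rw [← hxj]
      nlinarith
    have hv1 : v ≤ w := by
      rw [hv, div_le_iff₀ hB]
      have := h.edge_pt_succ (i := i) (by omega)
      rw [edge_pt] at this ⊢
      rw [edge_pt]
      have e1 : slope x r i * x j = slope x r i * ((1 - w) * x (i + 1) + w * x k) := by
        rw [← hxj]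
      nlinarith
    linarith
  refine ⟨u, v, 1 - u - v, div_nonneg hAj hA.le, div_nonneg hBj hB.le, by linarith, ?_⟩
  set z := u • pt x r (i + 1) + v • pt x r k + (1 - u - v) • apex x r i k with hz
  have e0 : z.1 = 1 := by
    simp only [hz, pt, apex, Prod.fst_add, Prod.smul_fst, smul_eq_mul]
    ring
  have e1 : edge x r i z = edge x r i (pt x r j) := by
    rw [hz, map_add, map_add, map_smul, map_smul, map_smul, edge_apex_left,
      h.edge_pt_succ (by omega), smul_eq_mul, smul_eq_mul, smul_eq_mul, hvB]
    ring
  have e2 : edge x r k z = edge x r k (pt x r j) := by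
    rw [hz, map_add, map_add, map_smul, map_smul, map_smul, h.edge_apex_right hik hk,
      edge_pt_self, smul_eq_mul, smul_eq_mul, smul_eq_mul, huA]
    ring
  obtain ⟨t, X, Y⟩ := z
  dsimp only at e0
  subst e0
  rw [edge_apply, edge_pt] at e1 e2
  have hs := h.slope_lt hik hk
  have hX : X = x j := by
    have : (slope x r k - slope x r i) * (X - x j) = 0 := by linarith
    rcases mul_eq_zero.1 this with h' | h' <;> linarith
  subst hX
  have hY : Y = r j * x j := by linarith
  rw [hY, pt]

/-- Both ends of the chain lie on or above every edge line, hence so does the chord between them.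
This applies also to the apices, which need not belong to the hull. -/
lemma chord_of_edge (h : IsLacunary n x r) {i : ℕ} (hi : i < n) {X Y : ℝ} (h0 : x 0 ≤ X)
    (hn : X ≤ x n) (hXY : edge x r i (1, X, Y) ≤ 0) :
    (Y - r 0 * x 0) * (x n - x 0) ≤ (r n * x n - r 0 * x 0) * (X - x 0) := by
  have h1 := h.edge_pt_nonneg hi (Nat.zero_le n)
  have h2 := h.edge_pt_nonneg hi le_rfl
  have h3 := h.x_lt (i := 0) (j := n) (by omega) le_rfl
  rw [edge_apply] at hXY
  rw [edge_pt] at h1 h2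
  nlinarith [mul_nonneg h1 (sub_nonneg.2 hn), mul_nonneg h2 (sub_nonneg.2 h0)]

/-- The cone over the chain is described by its edges. -/
lemma mem_hull (h : IsLacunary n x r) (hn : 0 < n) {X Y : ℝ} (h0 : x 0 ≤ X) (hX : X ≤ x n)
    (hedge : ∀ i, i < n → 0 ≤ edge x r i (1, X, Y))
    (hchord : (Y - r 0 * x 0) * (x n - x 0) ≤ (r n * x n - r 0 * x 0) * (X - x 0)) :
    ((1, X, Y) : ℝ × ℝ × ℝ) ∈ PointedCone.hull ℝ (pt x r '' {i | i ≤ n}) := by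
  obtain ⟨i, hi, hi1, hi2⟩ : ∃ i, i < n ∧ x i ≤ X ∧ X ≤ x (i + 1) := by
    by_contra! hcon
    have : ∀ i, i ≤ n → x i ≤ X := by
      intro i
      induction i with
      | zero => exact fun _ => h0
      | succ k ih => exact fun hk => (hcon k (by omega) (ih (by omega))).le
    have h1 := hcon (n - 1) (by omega) (this _ (by omega))
    rw [Nat.sub_add_cancel hn] at h1
    linarith
  set H := PointedCone.hull ℝ (pt x r '' {i | i ≤ n})
  have hp : ∀ j, j ≤ n → pt x r j ∈ H := fun j hj => Submodule.subset_span ⟨j, hj, rfl⟩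
  have hs : ∀ (c : ℝ) (z : ℝ × ℝ × ℝ), 0 ≤ c → z ∈ H → c • z ∈ H :=
    fun c z hc hz => H.smul_mem hc hz
  have hcomb : ∀ (w : ℝ) (a b : ℝ × ℝ × ℝ), 0 ≤ w → w ≤ 1 → a ∈ H → b ∈ H →
      (1 - w) • a + w • b ∈ H := fun w a b h0 h1 ha hb =>
    H.add_mem (hs _ _ (by linarith) ha) (hs _ _ h0 hb)
  have hxi := h.x_lt (i := i) (j := i + 1) (by omega) hi
  have hxn := h.x_lt hn le_rfl
  set u := (X - x i) / (x (i + 1) - x i) with hu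
  set v := (X - x 0) / (x n - x 0) with hv
  have hu' : u * (x (i + 1) - x i) = X - x i := div_mul_cancel₀ _ (by linarith)
  have hv' : v * (x n - x 0) = X - x 0 := div_mul_cancel₀ _ (by linarith)
  have h1 := hcomb u _ _ (div_nonneg (by linarith) (by linarith))
    (by rw [hu, div_le_one (by linarith)]; linarith) (hp i hi.le) (hp (i + 1) hi)
  have h2 := hcomb v _ _ (div_nonneg (by linarith) (by linarith))
    (by rw [hv, div_le_one (by linarith)]; linarith) (hp 0 (by omega)) (hp n le_rfl)
  -- `Y1` is the height of the chain at abscissa `X` and `Y2` that of the chord; the point is a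
  -- convex combination of the two.
  set Y1 := (1 - u) * (r i * x i) + u * (r (i + 1) * x (i + 1)) with hY1
  set Y2 := (1 - v) * (r 0 * x 0) + v * (r n * x n) with hY2
  have e1 : (1 - u) • pt x r i + u • pt x r (i + 1) = (1, X, Y1) := by
    simp only [pt, Prod.smul_mk, Prod.mk_add_mk, smul_eq_mul, Prod.mk.injEq]
    exact ⟨by ring, by linarith, rfl⟩
  have e2 : (1 - v) • pt x r 0 + v • pt x r n = (1, X, Y2) := by
    simp only [pt, Prod.smul_mk, Prod.mk_add_mk, smul_eq_mul, Prod.mk.injEq]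
    exact ⟨by ring, by linarith, rfl⟩
  rw [e1] at h1
  rw [e2] at h2
  have hY1Y : Y1 ≤ Y := by
    have a1 := hedge i hi
    have a2 : edge x r i (1, X, Y1) = 0 := by
      rw [← e1, map_add, map_smul, map_smul, edge_pt_self, h.edge_pt_succ hi]
      simp
    rw [edge_apply] at a1 a2
    linarith
  have hYY2 : Y ≤ Y2 := by
    have a1 : (Y2 - r 0 * x 0) * (x n - x 0) = (r n * x n - r 0 * x 0) * (X - x 0) := by
      rw [← hv', hY2]; ring
    rw [← a1] at hchord
    have := le_of_mul_le_mul_right hchord (by linarith)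
    linarith
  rcases (hY1Y.trans hYY2).eq_or_lt with h3 | h3
  · have : Y = Y1 := by linarith
    rw [this]
    exact h1
  · have h4 := hcomb ((Y - Y1) / (Y2 - Y1)) _ _ (div_nonneg (by linarith) (by linarith))
      (by rw [div_le_one (by linarith)]; linarith) h1 h2
    convert h4 using 1
    simp only [Prod.smul_mk, Prod.mk_add_mk, smul_eq_mul, Prod.mk.injEq]
    have : Y2 - Y1 ≠ 0 := by linarith
    refine ⟨by ring, by ring, ?_⟩
    field_simp
    ring

end IsLacunary

/-! ### The economical lift of a lacunary chain -/

/-- Scaling of functions `F a` of an index such that the scaled `F a` is the smallest one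
between the indices `g (a - 1)` and `g a`. -/
lemma exists_scaling (F : ℕ → ℕ → ℝ) (g : ℕ → ℕ) (n t : ℕ)
    (hpos : ∀ a, a + 1 < t → 0 < F a (g a) ∧ 0 < F (a + 1) (g a))
    (hle : ∀ a, a + 1 < t → ∀ j, j ≤ n →
      (j ≤ g a → F a j * F (a + 1) (g a) ≤ F a (g a) * F (a + 1) j) ∧
      (g a ≤ j → F a (g a) * F (a + 1) j ≤ F a j * F (a + 1) (g a))) :
    ∃ c : ℕ → ℝ, (∀ a, a < t → 0 < c a) ∧ ∀ a a' j, a < t → a' < t → j ≤ n →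
      (∀ e, a ≤ e → j ≤ g e) → (∀ e, e < a → g e ≤ j) → c a * F a j ≤ c a' * F a' j := by
  -- Consecutive scaled functions are made to agree at `g a`. To the left of it the former is the
  -- smaller one, to the right the latter, and this propagates along the indices.
  let c : ℕ → ℝ := fun a => Nat.rec 1 (fun a y => y * (F a (g a) / F (a + 1) (g a))) a
  have hc : ∀ a, c (a + 1) = c a * (F a (g a) / F (a + 1) (g a)) := fun a => rfl
  have hc0 : ∀ a, a < t → 0 < c a := by
    intro a
    induction a with
    | zero => exact fun _ => one_pos
    | succ k ih =>
      intro hk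
      have := ih (by omega)
      obtain ⟨h1, h2⟩ := hpos k hk
      rw [hc]
      positivity
  refine ⟨c, hc0, fun a a' j ha ha' hj hup hdown => ?_⟩
  rcases le_total a a' with h | h
  · induction a', h using Nat.le_induction with
    | base => exact le_rfl
    | succ k hk ih =>
      refine (ih (by omega)).trans ?_
      obtain ⟨h1, h2⟩ := hpos k ha'
      have h3 := (hle k ha' j hj).1 (hup k hk)
      have h4 := hc0 k (by omega)
      rw [hc, mul_assoc]
      refine mul_le_mul_of_nonneg_left ?_ h4.le
      rw [div_mul_eq_mul_div, le_div_iff₀ h2]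
      exact h3
  · have : ∀ d b, b + d = a → c a * F a j ≤ c b * F b j := by
      intro d
      induction d with
      | zero => rintro b rfl; exact le_rfl
      | succ k ih =>
        intro b hb
        refine (ih (b + 1) (by omega)).trans ?_
        obtain ⟨h1, h2⟩ := hpos b (by omega)
        have h3 := (hle b (by omega) j hj).2 (hdown b (by omega))
        have h4 := hc0 b (by omega)
        rw [hc, mul_assoc]
        refine mul_le_mul_of_nonneg_left ?_ h4.le
        rw [div_mul_eq_mul_div, div_le_iff₀ h2]
        exact h3
    exact this (a - a') a' (by omega)

namespace IsLacunary

variable {s : ℕ} {x r : ℕ → ℝ}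

/-- The three generators of the triangle around the `a`-th block of the chain. -/
noncomputable def blockGen (s : ℕ) (x r : ℕ → ℝ) (p : Fin s × Fin 3) : ℝ × ℝ × ℝ :=
  ![pt x r (p.1 * (s + 2) + 1), pt x r (p.1 * (s + 2) + s + 1),
    apex x r (p.1 * (s + 2)) (p.1 * (s + 2) + s + 1)] p.2

lemma block_lt {a s : ℕ} (ha : a < s) : a * (s + 2) + s + 1 < s * (s + 2) := by
  have := Nat.mul_le_mul_right (s + 2) (Nat.succ_le_of_lt ha)
  rw [Nat.succ_mul] at this
  omega

lemma block_le {a e s : ℕ} (ha : a < e) : a * (s + 2) + s + 2 ≤ e * (s + 2) := by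
  have := Nat.mul_le_mul_right (s + 2) (Nat.succ_le_of_lt ha)
  rw [Nat.succ_mul] at this
  omega

lemma blockGen_fst (p : Fin s × Fin 3) : (blockGen s x r p).1 = 1 := by
  obtain ⟨a, k⟩ := p
  fin_cases k <;> rfl

lemma edge_blockGen_nonneg (h : IsLacunary (s * (s + 2)) x r) (p : Fin s × Fin 3) {e : ℕ}
    (he : e < s * (s + 2)) (hout : e ≤ p.1 * (s + 2) ∨ p.1 * (s + 2) + s + 1 ≤ e) :
    0 ≤ edge x r e (blockGen s x r p) := by
  obtain ⟨a, k⟩ := p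
  change e ≤ a * (s + 2) ∨ a * (s + 2) + s + 1 ≤ e at hout
  have ha := block_lt a.2
  have hs : 0 < s := a.pos
  fin_cases k
  · exact h.edge_pt_nonneg (j := a * (s + 2) + 1) he (by omega)
  · exact h.edge_pt_nonneg (j := a * (s + 2) + s + 1) he (by omega)
  · exact h.edge_apex_nonneg (by omega) ha he hout

lemma x_blockGen (h : IsLacunary (s * (s + 2)) x r) (p : Fin s × Fin 3) :
    x 0 ≤ (blockGen s x r p).2.1 ∧ (blockGen s x r p).2.1 ≤ x (s * (s + 2)) := by
  obtain ⟨a, k⟩ := p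
  have ha := block_lt a.2
  have hs : 0 < s := a.pos
  fin_cases k
  · exact ⟨h.x_le (j := a * (s + 2) + 1) (by omega) (by omega),
      h.x_le (i := a * (s + 2) + 1) (by omega) (by omega)⟩
  · exact ⟨h.x_le (j := a * (s + 2) + s + 1) (by omega) (by omega),
      h.x_le (i := a * (s + 2) + s + 1) (by omega) (by omega)⟩
  · exact ⟨(h.x_le (j := a * (s + 2) + 1) (by omega) (by omega)).trans
      (h.x_le_apex (i := a * (s + 2)) (k := a * (s + 2) + s + 1) (by omega) ha),
      (h.apex_le_x (i := a * (s + 2)) (k := a * (s + 2) + s + 1) (by omega) ha).trans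
        (h.x_le (i := a * (s + 2) + s + 1) (by omega) (by omega))⟩

lemma chord_blockGen (h : IsLacunary (s * (s + 2)) x r) (p : Fin s × Fin 3) :
    ((blockGen s x r p).2.2 - r 0 * x 0) * (x (s * (s + 2)) - x 0) ≤
      (r (s * (s + 2)) * x (s * (s + 2)) - r 0 * x 0) * ((blockGen s x r p).2.1 - x 0) := by
  have hx := h.x_blockGen p
  obtain ⟨a, k⟩ := p
  have ha := block_lt a.2
  have hs : 0 < s := a.pos
  fin_cases k
  · exact h.chord_of_edge (i := a * (s + 2) + 1) (by omega) hx.1 hx.2 (edge_pt_self x r _).le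
  · exact h.chord_of_edge (i := a * (s + 2) + s + 1) (by omega) hx.1 hx.2 (edge_pt_self x r _).le
  · exact h.chord_of_edge (i := a * (s + 2)) (by omega) hx.1 hx.2 (edge_apex_left x r _ _).le

/-- A scaling of the forms of the `b`-th edges of all blocks such that on each block its own form
is the smallest one. -/
lemma exists_edge_scaling (h : IsLacunary (s * (s + 2)) x r) {b : ℕ} (hb : b < s) :
    ∃ c : ℕ → ℝ, (∀ a, a < s → 0 < c a) ∧ ∀ (p : Fin s × Fin 3) (a' : ℕ), a' < s →
      c p.1 * edge x r (p.1 * (s + 2) + 1 + b) (blockGen s x r p) ≤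
        c a' * edge x r (a' * (s + 2) + 1 + b) (blockGen s x r p) := by
  -- The forms of consecutive blocks are matched at the points with index `(a + 1) * (s + 2)`, which
  -- separate the blocks and belong to none of them.
  obtain ⟨c, hc, hle⟩ := exists_scaling
    (fun a j => edge x r (a * (s + 2) + 1 + b) (pt x r j)) (fun a => (a + 1) * (s + 2))
    (s * (s + 2)) s
    (by
      intro a ha
      have h1 := block_lt ha
      simp only [Nat.succ_mul] at h1 ⊢
      exact ⟨h.edge_pt_pos (by omega) (by omega) (by omega) (by omega),
        h.edge_pt_pos (by omega) (by omega) (by omega) (by omega)⟩)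
    (by
      intro a ha j hj
      have h1 := block_lt ha
      simp only [Nat.succ_mul] at h1 ⊢
      exact h.edge_mul_edge_le (by omega) (by omega) (by omega) hj)
  refine ⟨c, hc, ?_⟩
  rintro ⟨a, k⟩ a' ha'
  have ha := block_lt a.2
  have hs : 0 < s := a.pos
  have hpt : ∀ j : ℕ, a * (s + 2) + 1 ≤ j → j ≤ a * (s + 2) + s + 1 →
      c a * edge x r (a * (s + 2) + 1 + b) (pt x r j) ≤
        c a' * edge x r (a' * (s + 2) + 1 + b) (pt x r j) := by
    intro j h1 h2
    refine hle a a' j a.2 ha' (by omega) (fun e he => ?_) (fun e he => ?_)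
    · have := block_le (s := s) (Nat.lt_succ_of_le he)
      simp only [Nat.succ_eq_add_one] at this
      omega
    · have := block_le (s := s) he
      rw [Nat.succ_mul]
      omega
  fin_cases k
  · exact hpt (a * (s + 2) + 1) le_rfl (by omega)
  · exact hpt (a * (s + 2) + s + 1) (by omega) le_rfl
  -- At the apex no scaling matters: the own inner edge is nonpositive, the edges of other blocks
  -- are nonnegative.
  · by_cases haa : a' = a
    · rw [haa]
    · refine (mul_nonpos_of_nonneg_of_nonpos (hc a a.2).le
        (h.edge_apex_nonpos ha (by dsimp only; omega) (by dsimp only; omega))).trans ?_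
      refine mul_nonneg (hc a' ha').le (h.edge_apex_nonneg (by omega) ha ?_ ?_)
      · have := block_lt ha'
        omega
      · rcases lt_or_gt_of_ne haa with hlt | hgt
        · have := block_le (s := s) hlt
          dsimp only
          omega
        · have := block_le (s := s) hgt
          dsimp only
          omega

/-- A lacunary chain has a large subset that can be lifted with few inequalities. -/
theorem exists_hasConeLift (h : IsLacunary (s * (s + 2)) x r) (hs : 0 < s) :
    ∃ J : Finset ℕ, (∀ j ∈ J, j ≤ s * (s + 2)) ∧ J.card = s * (s + 1) ∧
      ∃ C : Set (ℝ × ℝ × ℝ), HasConeLift C (4 * s) ∧ (∀ j ∈ J, pt x r j ∈ C) ∧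
        C ⊆ PointedCone.hull ℝ (pt x r '' {i | i ≤ s * (s + 2)}) := by
  have hsc : ∀ b : Fin s, ∃ c : ℕ → ℝ, (∀ a, a < s → 0 < c a) ∧
      ∀ (p : Fin s × Fin 3) (a' : ℕ), a' < s →
        c p.1 * edge x r (p.1 * (s + 2) + 1 + b) (blockGen s x r p) ≤
          c a' * edge x r (a' * (s + 2) + 1 + b) (blockGen s x r p) :=
    fun b => h.exists_edge_scaling b.2
  choose c hc0 hc using hsc
  let Φ : (Fin s × Fin 3 → ℝ) →ₗ[ℝ] ℝ × ℝ × ℝ := Fintype.linearCombination ℝ (blockGen s x r)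
  have hΦ : ∀ v, Φ v = ∑ p, v p • blockGen s x r p := fun v =>
    Fintype.linearCombination_apply ℝ _ v
  have hform : ∀ (g : ℝ × ℝ × ℝ →ₗ[ℝ] ℝ) v, g (Φ v) = ∑ p, v p * g (blockGen s x r p) := by
    intro g v
    rw [hΦ, map_sum]
    simp
  -- One form for each `b`, shared by all blocks: `s` conditions instead of `s ^ 2`.
  let β : Fin s → (Fin s × Fin 3 → ℝ) →ₗ[ℝ] ℝ := fun b => Fintype.linearCombination ℝ
    fun p : Fin s × Fin 3 => c b p.1 * edge x r (p.1 * (s + 2) + 1 + b) (blockGen s x r p)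
  have hβ : ∀ b v, β b v = ∑ p, v p *
      (c b p.1 * edge x r (p.1 * (s + 2) + 1 + b) (blockGen s x r p)) := fun b v => by
    simp [β, Fintype.linearCombination_apply]
  let f : (Fin s × Fin 3) ⊕ Fin s → (Fin s × Fin 3 → ℝ) →ₗ[ℝ] ℝ :=
    Sum.elim (fun p => LinearMap.proj p) β
  let J : Finset ℕ := (Finset.univ : Finset (Fin s × Fin (s + 1))).image
    fun q => q.1 * (s + 2) + 1 + q.2
  have hfst : ∀ v, (Φ v).1 = ∑ p, v p := by
    intro v
    have := hform (LinearMap.fst ℝ ℝ (ℝ × ℝ)) v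
    simpa [blockGen_fst] using this
  refine ⟨J, ?_, ?_, Φ '' {v | ∀ i, 0 ≤ f i v},
    ⟨Fin s × Fin 3 → ℝ, inferInstance, inferInstance, inferInstance, (Fin s × Fin 3) ⊕ Fin s,
      inferInstance, f, Φ, ?_, ?_, rfl⟩, ?_, ?_⟩
  · intro j hj
    obtain ⟨⟨a, b⟩, -, rfl⟩ := Finset.mem_image.1 hj
    have := block_lt a.2
    have := b.2
    dsimp only
    omega
  · rw [Finset.card_image_of_injective]
    · simp
    · rintro ⟨a, b⟩ ⟨a', b'⟩ hab
      dsimp only at hab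
      have hb := b.2
      have hb' := b'.2
      rcases lt_trichotomy a.1 a'.1 with h1 | h1 | h1
      · have := block_le (s := s) h1
        omega
      · rw [h1] at hab
        exact Prod.ext (Fin.ext h1) (Fin.ext (by dsimp only; omega))
      · have := block_le (s := s) h1
        omega
  · simp only [Fintype.card_sum, Fintype.card_prod, Fintype.card_fin]
    omega
  · intro v hv h0
    have h1 := hfst v
    rw [h0] at h1
    have h2 : ∀ p ∈ Finset.univ, 0 ≤ v p := fun p _ => hv (Sum.inl p)
    have h3 := (Finset.sum_eq_zero_iff_of_nonneg h2).1 h1.symm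
    ext p
    exact h3 p (Finset.mem_univ p)
  · intro j hj
    obtain ⟨⟨a, b⟩, -, rfl⟩ := Finset.mem_image.1 hj
    have ha := block_lt a.2
    have hb := b.2
    dsimp only
    obtain ⟨u, v, w, hu, hv, hw, he⟩ := h.exists_pt_eq (i := a * (s + 2))
      (j := a * (s + 2) + 1 + b) (k := a * (s + 2) + s + 1) (by omega) ha (by omega) (by omega)
    -- The weight sits on one block only, so every `β b'` reduces to a positive multiple of one edge
    -- form at a point of the chain.
    let y : Fin s × Fin 3 → ℝ := fun p => if p.1 = a then ![u, v, w] p.2 else 0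
    have hy : ∀ g : Fin s × Fin 3 → ℝ × ℝ × ℝ, ∑ p, y p • g p =
        u • g (a, 0) + v • g (a, 1) + w • g (a, 2) := by
      intro g
      rw [Fintype.sum_prod_type, Finset.sum_eq_single a]
      · simp [y, Fin.sum_univ_three]
      · intro a' _ hne
        simp [y, hne]
      · simp
    have hyΦ : Φ y = pt x r (a * (s + 2) + 1 + b) := by
      rw [hΦ, hy, he]
      rfl
    refine ⟨y, ?_, hyΦ⟩
    have hy0 : ∀ p, 0 ≤ y p := by
      rintro ⟨a', k⟩
      by_cases haa : a' = a
      · fin_cases k <;> simp [y, haa, hu, hv, hw]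
      · simp [y, haa]
    rintro (p | b')
    · exact hy0 p
    · have h1 : β b' y = c b' a * edge x r (a * (s + 2) + 1 + b') (Φ y) := by
        rw [hβ, hform, Finset.mul_sum]
        refine Finset.sum_congr rfl ?_
        rintro ⟨a', k⟩ -
        by_cases haa : a' = a
        · subst haa; ring
        · simp [y, haa]
      have hb' := b'.2
      change 0 ≤ β b' y
      rw [h1, hyΦ]
      exact mul_nonneg (hc0 b' a a.2).le (h.edge_pt_nonneg (by omega) (by omega))
  · rintro _ ⟨v, hv, rfl⟩
    have hv0 : ∀ p, 0 ≤ v p := fun p => hv (Sum.inl p)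
    -- The edges with remainder `0` or `s + 1` bound the blocks and are nonnegative on all
    -- generators; only the inner ones, with `b = q - 1`, need `β`.
    have hedge : ∀ e, e < s * (s + 2) → 0 ≤ edge x r e (Φ v) := by
      intro e he
      have hdm := Nat.div_add_mod' e (s + 2)
      have hmod := Nat.mod_lt e (show 0 < s + 2 by omega)
      set a := e / (s + 2)
      set q := e % (s + 2)
      have has : a < s := by
        by_contra hcon
        have := Nat.mul_le_mul_right (s + 2) (not_lt.1 hcon)
        omega
      rcases lt_or_ge 0 q with hq | hq
      · rcases lt_or_ge q (s + 1) with hq' | hq'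
        · have hb : q - 1 < s := by omega
          have he' : a * (s + 2) + 1 + (q - 1) = e := by omega
          have hca := hc0 ⟨q - 1, hb⟩ a has
          -- By minimality, replacing the own edge of each block by that of block `a` can only
          -- increase the sum.
          have h1 : β ⟨q - 1, hb⟩ v ≤ c ⟨q - 1, hb⟩ a * edge x r e (Φ v) := by
            rw [hβ, hform, Finset.mul_sum]
            refine Finset.sum_le_sum fun p _ => ?_
            have h2 := mul_le_mul_of_nonneg_left (hc ⟨q - 1, hb⟩ p a has) (hv0 p)
            dsimp only at h2
            rw [he'] at h2
            linarith
          have h3 : 0 ≤ β ⟨q - 1, hb⟩ v := hv (Sum.inr ⟨q - 1, hb⟩)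
          exact nonneg_of_mul_nonneg_right (h3.trans h1) hca
        · rw [hform]
          refine Finset.sum_nonneg fun p _ => mul_nonneg (hv0 p)
            (h.edge_blockGen_nonneg p he ?_)
          rcases le_or_gt p.1.1 a with h1 | h1
          · right
            have := Nat.mul_le_mul_right (s + 2) h1
            omega
          · left
            have := block_le (s := s) h1
            omega
      · rw [hform]
        refine Finset.sum_nonneg fun p _ => mul_nonneg (hv0 p)
          (h.edge_blockGen_nonneg p he ?_)
        rcases lt_or_ge p.1.1 a with h1 | h1
        · right
          have := block_le (s := s) h1
          omega
        · left
          have := Nat.mul_le_mul_right (s + 2) h1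
          omega
    have hn : 0 < s * (s + 2) := by positivity
    rcases (Finset.sum_nonneg fun p (_ : p ∈ Finset.univ) => hv0 p).eq_or_lt with h0 | h0
    · have h3 := (Finset.sum_eq_zero_iff_of_nonneg fun p _ => hv0 p).1 h0.symm
      have : v = 0 := by
        ext p
        exact h3 p (Finset.mem_univ p)
      rw [this, map_zero]
      exact Submodule.zero_mem _
    · have h1 := hfst v
      have hX : ∀ g : ℝ × ℝ × ℝ →ₗ[ℝ] ℝ, (∀ p, 0 ≤ g (blockGen s x r p)) → 0 ≤ g (Φ v) := by
        intro g hg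
        rw [hform]
        exact Finset.sum_nonneg fun p _ => mul_nonneg (hv0 p) (hg p)
      generalize hz : Φ v = z at *
      obtain ⟨t, X, Y⟩ := z
      dsimp only at h1
      rw [← h1] at h0
      have hx1 := hX (LinearMap.fst ℝ ℝ ℝ ∘ₗ LinearMap.snd ℝ ℝ (ℝ × ℝ)
        - x 0 • LinearMap.fst ℝ ℝ (ℝ × ℝ)) (fun p => by
          have := (h.x_blockGen p).1
          simpa [blockGen_fst] using this)
      have hx2 := hX (x (s * (s + 2)) • LinearMap.fst ℝ ℝ (ℝ × ℝ)
        - LinearMap.fst ℝ ℝ ℝ ∘ₗ LinearMap.snd ℝ ℝ (ℝ × ℝ)) (fun p => by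
          have := (h.x_blockGen p).2
          simpa [blockGen_fst] using this)
      have hx3 := hX ((r (s * (s + 2)) * x (s * (s + 2)) - r 0 * x 0) •
          (LinearMap.fst ℝ ℝ ℝ ∘ₗ LinearMap.snd ℝ ℝ (ℝ × ℝ) - x 0 • LinearMap.fst ℝ ℝ (ℝ × ℝ))
        - (x (s * (s + 2)) - x 0) • (LinearMap.snd ℝ ℝ ℝ ∘ₗ LinearMap.snd ℝ ℝ (ℝ × ℝ)
          - (r 0 * x 0) • LinearMap.fst ℝ ℝ (ℝ × ℝ))) (fun p => by
          have := h.chord_blockGen p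
          simp only [LinearMap.sub_apply, LinearMap.smul_apply, LinearMap.comp_apply,
            LinearMap.fst_apply, LinearMap.snd_apply, blockGen_fst, smul_eq_mul]
          linarith)
      simp only [LinearMap.sub_apply, LinearMap.smul_apply, LinearMap.comp_apply,
        LinearMap.fst_apply, LinearMap.snd_apply, smul_eq_mul] at hx1 hx2 hx3
      have ht : ∀ a : ℝ, t * (t⁻¹ * a) = a := fun a => by field_simp
      have hmem := h.mem_hull hn (X := t⁻¹ * X) (Y := t⁻¹ * Y) ?_ ?_ ?_ ?_
      · have h4 : ((t, X, Y) : ℝ × ℝ × ℝ) = t • (1, t⁻¹ * X, t⁻¹ * Y) := by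
          simp [ht]
        rw [h4]
        exact Submodule.smul_mem _ (⟨t, h0.le⟩ : {c : ℝ // 0 ≤ c}) hmem
      · rw [inv_mul_eq_div, le_div_iff₀ h0]; linarith
      · rw [inv_mul_eq_div, div_le_iff₀ h0]; linarith
      · intro i hi
        have h4 := hedge i hi
        rw [edge_apply] at h4 ⊢
        refine nonneg_of_mul_nonneg_right (a := t) ?_ h0
        refine h4.trans_eq ?_
        rw [mul_add, mul_sub, ht, mul_left_comm, ht]
        ring
      · refine le_of_mul_le_mul_left ?_ h0
        have e1 : t * ((t⁻¹ * Y - r 0 * x 0) * (x (s * (s + 2)) - x 0)) =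
            (Y - r 0 * x 0 * t) * (x (s * (s + 2)) - x 0) := by
          linear_combination (x (s * (s + 2)) - x 0) * ht Y
        have e2 : t * ((r (s * (s + 2)) * x (s * (s + 2)) - r 0 * x 0) * (t⁻¹ * X - x 0)) =
            (r (s * (s + 2)) * x (s * (s + 2)) - r 0 * x 0) * (X - x 0 * t) := by
          linear_combination (r (s * (s + 2)) * x (s * (s + 2)) - r 0 * x 0) * ht X
        rw [e1, e2]
        linarith

end IsLacunary

/-! ### Extraction of lacunary chains from convex chains -/

section Extraction

variable {ι : Type*} [LinearOrder ι]

/-- In every triple the middle value of `f` is at least as close to the left one. -/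
def Growth (T : Finset ι) (f : ι → ℝ) : Prop :=
  ∀ a ∈ T, ∀ b ∈ T, ∀ c ∈ T, a < b → b < c → f b - f a ≤ f c - f b

/-- In every triple the middle value of `f` is at least as close to the right one. -/
def Decay (T : Finset ι) (f : ι → ℝ) : Prop :=
  ∀ a ∈ T, ∀ b ∈ T, ∀ c ∈ T, a < b → b < c → f c - f b ≤ f b - f a

lemma Growth.mono {T U : Finset ι} {f : ι → ℝ} (h : Growth T f) (hU : U ⊆ T) : Growth U f :=
  fun a ha b hb c hc => h a (hU ha) b (hU hb) c (hU hc)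

/-- Points are split according to which extreme value of `f` is nearer. If half of them are near the
minimum, the maximum can be appended to any `Growth` set among them; otherwise the minimum can be
prepended to any `Decay` set. Each halving thus gains one element. -/
lemma exists_growth_or_decay (k l : ℕ) (T : Finset ι) (f : ι → ℝ) (hf : StrictMonoOn f T)
    (hT : 2 ^ (k + l) ≤ T.card) :
    (∃ U ⊆ T, k ≤ U.card ∧ Growth U f) ∨ ∃ U ⊆ T, l ≤ U.card ∧ Decay U f := by
  induction hm : k + l generalizing k l T with
  | zero =>
    left
    exact ⟨∅, by simp, by omega, by simp [Growth]⟩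
  | succ m ih =>
    rcases Nat.eq_zero_or_pos k with rfl | hk
    · left; exact ⟨∅, by simp, by simp, by simp [Growth]⟩
    rcases Nat.eq_zero_or_pos l with rfl | hl
    · right; exact ⟨∅, by simp, by simp, by simp [Decay]⟩
    have hcard : 2 ^ m + 2 ^ m ≤ T.card := by
      rw [hm, pow_succ] at hT
      omega
    have hne : T.Nonempty := Finset.card_pos.1 (by have := Nat.two_pow_pos m; omega)
    set p := T.min' hne with hp
    set q := T.max' hne with hq
    have hpT : p ∈ T := T.min'_mem hne
    have hqT : q ∈ T := T.max'_mem hne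
    have hpq : p < q := by
      refine lt_of_le_of_ne (T.min'_le _ hqT) fun h => ?_
      have : T ⊆ {p} := fun x hx => by
        rw [Finset.mem_singleton]
        exact le_antisymm ((T.le_max' _ hx).trans h.ge) (T.min'_le _ hx)
      have := Finset.card_le_card this
      rw [Finset.card_singleton] at this
      have h2 : 2 ≤ 2 ^ m := by
        have : 1 ≤ m := by omega
        calc 2 = 2 ^ 1 := rfl
          _ ≤ 2 ^ m := Nat.pow_le_pow_right (by norm_num) this
      omega
    have hfpq := hf hpT hqT hpq
    set L := T.filter fun x => f x - f p ≤ f q - f x with hL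
    set R := T.filter fun x => ¬ (f x - f p ≤ f q - f x) with hR
    have hLR : L.card + R.card = T.card :=
      Finset.card_filter_add_card_filter_not (s := T) (fun x => f x - f p ≤ f q - f x)
    rcases le_or_gt (2 ^ m) L.card with h | h
    · obtain ⟨U, hU, hUc, hUg⟩ | ⟨U, hU, hUc, hUd⟩ :=
        ih (k - 1) l L (hf.mono (Finset.filter_subset _ _))
          (by rw [show k - 1 + l = m by omega]; exact h) (by omega)
      · left
        have hqU : q ∉ U := fun hqU => by
          have := (Finset.mem_filter.1 (hU hqU)).2
          linarith
        have hUT : U ⊆ T := hU.trans (Finset.filter_subset _ _)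
        have hlt : ∀ x ∈ U, x < q := fun x hx =>
          lt_of_le_of_ne (T.le_max' _ (hUT hx)) (fun h => hqU (h ▸ hx))
        refine ⟨insert q U, Finset.insert_subset hqT hUT, ?_, ?_⟩
        · rw [Finset.card_insert_of_notMem hqU]; omega
        · intro a ha b hb c hc hab hbc
          have hqc : c ≤ q := by
            rcases Finset.mem_insert.1 hc with rfl | hc
            · exact le_rfl
            · exact (hlt c hc).le
          have hbU : b ∈ U := (Finset.mem_insert.1 hb).resolve_left (hbc.trans_le hqc).ne
          have haU : a ∈ U :=
            (Finset.mem_insert.1 ha).resolve_left ((hab.trans hbc).trans_le hqc).ne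
          rcases Finset.mem_insert.1 hc with rfl | hcU
          · have h1 := (Finset.mem_filter.1 (hU hbU)).2
            have h2 := hf.monotoneOn hpT (hUT haU) (T.min'_le _ (hUT haU))
            linarith
          · exact hUg a haU b hbU c hcU hab hbc
      · right
        exact ⟨U, hU.trans (Finset.filter_subset _ _), hUc, hUd⟩
    · have h' : 2 ^ m ≤ R.card := by omega
      obtain ⟨U, hU, hUc, hUg⟩ | ⟨U, hU, hUc, hUd⟩ :=
        ih k (l - 1) R (hf.mono (Finset.filter_subset _ _))
          (by rw [show k + (l - 1) = m by omega]; exact h') (by omega)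
      · left
        exact ⟨U, hU.trans (Finset.filter_subset _ _), hUc, hUg⟩
      · right
        have hpU : p ∉ U := fun hpU => by
          have := (Finset.mem_filter.1 (hU hpU)).2
          linarith
        have hUT : U ⊆ T := hU.trans (Finset.filter_subset _ _)
        have hlt : ∀ x ∈ U, p < x := fun x hx =>
          lt_of_le_of_ne (T.min'_le _ (hUT hx)) (fun h => hpU (h ▸ hx))
        refine ⟨insert p U, Finset.insert_subset hpT hUT, ?_, ?_⟩
        · rw [Finset.card_insert_of_notMem hpU]; omega
        · intro a ha b hb c hc hab hbc
          have hpa : p ≤ a := by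
            rcases Finset.mem_insert.1 ha with rfl | ha
            · exact le_rfl
            · exact (hlt a ha).le
          have hbU : b ∈ U := (Finset.mem_insert.1 hb).resolve_left (hpa.trans_lt hab).ne'
          have hcU : c ∈ U :=
            (Finset.mem_insert.1 hc).resolve_left (hpa.trans_lt (hab.trans hbc)).ne'
          rcases Finset.mem_insert.1 ha with rfl | haU
          · have h1 := (Finset.mem_filter.1 (hU hbU)).2
            have h2 := hf.monotoneOn (hUT hcU) hqT (T.le_max' _ (hUT hcU))
            linarith
          · exact hUd a haU b hbU c hcU hab hbc

lemma Finset.exists_enum (T : Finset ι) (hT : T.Nonempty) :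
    ∃ τ : ℕ → ι, (∀ k, k < T.card → τ k ∈ T) ∧ ∀ i j, i < j → j < T.card → τ i < τ j := by
  obtain ⟨a, -⟩ := hT
  refine ⟨fun k => if h : k < T.card then T.orderEmbOfFin rfl ⟨k, h⟩ else a, ?_, ?_⟩
  · intro k hk
    simp [hk, Finset.orderEmbOfFin_mem]
  · intro i j hij hj
    simp [hj, hij.trans hj, hij]

/-- Some points `v i`, `i ∈ T`, form a lacunary chain with `n + 1` points in suitable projective
coordinates. -/
def HasLacunaryChain {ι : Type*} (n : ℕ) (v : ι → ℝ × ℝ × ℝ) (T : Finset ι) : Prop :=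
  ∃ (x r c : ℕ → ℝ) (q : ℕ → ι) (e : (ℝ × ℝ × ℝ) ≃ₗ[ℝ] ℝ × ℝ × ℝ), IsLacunary n x r ∧
    ∀ k, k ≤ n → q k ∈ T ∧ 0 < c k ∧ e (v (q k)) = c k • IsLacunary.pt x r k

lemma HasLacunaryChain.mono {ι : Type*} {n : ℕ} {v : ι → ℝ × ℝ × ℝ} {T U : Finset ι}
    (h : HasLacunaryChain n v U) (hU : U ⊆ T) : HasLacunaryChain n v T := by
  obtain ⟨x, r, c, q, e, hl, hq⟩ := h
  exact ⟨x, r, c, q, e, hl, fun k hk => ⟨hU (hq k hk).1, (hq k hk).2⟩⟩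

lemma HasLacunaryChain.of_equiv {ι : Type*} {n : ℕ} {v v' : ι → ℝ × ℝ × ℝ} {T : Finset ι}
    (h : HasLacunaryChain n v' T) (e' : (ℝ × ℝ × ℝ) ≃ₗ[ℝ] ℝ × ℝ × ℝ)
    (he : ∀ i, e' (v i) = v' i) : HasLacunaryChain n v T := by
  obtain ⟨x, r, c, q, e, hl, hq⟩ := h
  refine ⟨x, r, c, q, e'.trans e, hl, fun k hk => ⟨(hq k hk).1, (hq k hk).2.1, ?_⟩⟩
  rw [LinearEquiv.trans_apply, he]
  exact (hq k hk).2.2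

lemma HasLacunaryChain.of_dual {ι : Type*} {n : ℕ} {v : ι → ℝ × ℝ × ℝ} {T : Finset ι}
    (h : HasLacunaryChain n (fun i : ιᵒᵈ => v (OrderDual.ofDual i))
      (T.map OrderDual.toDual.toEmbedding)) : HasLacunaryChain n v T := by
  obtain ⟨x, r, c, q, e, hl, hq⟩ := h
  refine ⟨x, r, c, fun k => OrderDual.ofDual (q k), e, hl, fun k hk => ⟨?_, (hq k hk).2⟩⟩
  obtain ⟨i, hi, hiq⟩ := Finset.mem_map.1 (hq k hk).1
  change OrderDual.ofDual (q k) ∈ T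
  rw [← hiq]
  exact hi

/-- The affine change of coordinates `(X, Y) ↦ (X - a, Y - b)`. -/
def translateEquiv (a b : ℝ) : (ℝ × ℝ × ℝ) ≃ₗ[ℝ] ℝ × ℝ × ℝ where
  toFun z := (z.1, z.2.1 - a * z.1, z.2.2 - b * z.1)
  invFun z := (z.1, z.2.1 + a * z.1, z.2.2 + b * z.1)
  map_add' z w := by ext <;> simp <;> ring
  map_smul' c z := by ext <;> simp <;> ring
  left_inv z := by ext <;> simp
  right_inv z := by ext <;> simp

/-- The affine change of coordinates `(X, Y) ↦ (-X, Y - b * X)`. -/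
def reflectEquiv (b : ℝ) : (ℝ × ℝ × ℝ) ≃ₗ[ℝ] ℝ × ℝ × ℝ where
  toFun z := (z.1, -z.2.1, z.2.2 - b * z.2.1)
  invFun z := (z.1, -z.2.1, z.2.2 - b * z.2.1)
  map_add' z w := by ext <;> simp <;> ring
  map_smul' c z := by ext <;> simp; ring
  left_inv z := by ext <;> simp
  right_inv z := by ext <;> simp

/-- The affine change of coordinates `(X, Y) ↦ (X, Y - b * X)`. -/
def shearEquiv (b : ℝ) : (ℝ × ℝ × ℝ) ≃ₗ[ℝ] ℝ × ℝ × ℝ where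
  toFun z := (z.1, z.2.1, z.2.2 - b * z.2.1)
  invFun z := (z.1, z.2.1, z.2.2 + b * z.2.1)
  map_add' z w := by ext <;> simp; ring
  map_smul' c z := by ext <;> simp; ring
  left_inv z := by ext <;> simp
  right_inv z := by ext <;> simp

/-- The affine change of coordinates `(X, Y) ↦ (-Y, X)`. -/
def rotateEquiv : (ℝ × ℝ × ℝ) ≃ₗ[ℝ] ℝ × ℝ × ℝ where
  toFun z := (z.1, -z.2.2, z.2.1)
  invFun z := (z.1, z.2.2, -z.2.1)
  map_add' z w := by ext <;> simp; ring
  map_smul' c z := by ext <;> simp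
  left_inv z := by ext <;> simp
  right_inv z := by ext <;> simp

/-- The projective change of coordinates `(X, Y) ↦ (1 / (Y - b), (X - a) / (Y - b))`. -/
def hyperbolaEquiv (a b : ℝ) : (ℝ × ℝ × ℝ) ≃ₗ[ℝ] ℝ × ℝ × ℝ where
  toFun z := (z.2.2 - b * z.1, z.1, z.2.1 - a * z.1)
  invFun z := (z.2.1, z.2.2 + a * z.2.1, z.1 + b * z.2.1)
  map_add' z w := by ext <;> simp <;> ring
  map_smul' c z := by ext <;> simp <;> ring
  left_inv z := by ext <;> simp
  right_inv z := by ext <;> simp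

/-- The first point becomes the origin and every fourth point is kept. Between two kept points the
chord slope doubles twice; one factor of two is lost in passing from the last chord to the slope
seen from the origin, since by growth that chord covers at least half of the abscissa. -/
lemma hasLacunaryChain_of_double {n : ℕ} {T : Finset ι} {X Y : ι → ℝ} (hX : StrictMonoOn X T)
    (hY : StrictMonoOn Y T) (hG : Growth T X)
    (hS : ∀ a ∈ T, ∀ b ∈ T, ∀ c ∈ T, ∀ d ∈ T, a < b → b < c → c < d →
      2 * ((Y b - Y a) * (X d - X c)) ≤ (Y d - Y c) * (X b - X a))
    (hT : 4 * (n + 1) < T.card) : HasLacunaryChain n (fun i => (1, X i, Y i)) T := by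
  obtain ⟨τ, hτT, hτ⟩ := T.exists_enum (Finset.card_pos.1 (by omega))
  set o := τ 0
  have ho : o ∈ T := hτT 0 (by omega)
  have hoT : ∀ k, 0 < k → k < T.card → o < τ k := fun k h0 hk => hτ 0 k h0 hk
  have hXo : ∀ k, 0 < k → k < T.card → 0 < X (τ k) - X o := fun k h0 hk =>
    sub_pos.2 (hX ho (hτT k hk) (hoT k h0 hk))
  have hYo : ∀ k, 0 < k → k < T.card → 0 < Y (τ k) - Y o := fun k h0 hk =>
    sub_pos.2 (hY ho (hτT k hk) (hoT k h0 hk))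
  refine ⟨fun k => X (τ (4 * (k + 1))) - X o,
    fun k => (Y (τ (4 * (k + 1))) - Y o) / (X (τ (4 * (k + 1))) - X o), fun _ => 1,
    fun k => τ (4 * (k + 1)), translateEquiv (X o) (Y o), ⟨?_, ?_, ?_, ?_⟩, ?_⟩
  · exact fun k hk => hXo _ (by omega) (by omega)
  · exact fun k hk => div_pos (hYo _ (by omega) (by omega)) (hXo _ (by omega) (by omega))
  · intro i j hij hj
    have := hG o ho _ (hτT (4 * (i + 1)) (by omega)) _ (hτT (4 * (j + 1)) (by omega))
      (hoT _ (by omega) (by omega)) (hτ _ _ (by omega) (by omega))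
    linarith
  · intro i j hij hj
    set m := 4 * (i + 1)
    set l := 4 * (j + 1)
    have hb : m + 4 ≤ l := by omega
    have hl : l < T.card := by omega
    have p1 := hS o ho _ (hτT m (by omega)) _ (hτT (m + 1) (by omega)) _ (hτT (m + 2) (by omega))
      (hoT _ (by omega) (by omega)) (hτ _ _ (by omega) (by omega)) (hτ _ _ (by omega) (by omega))
    have p2 := hS _ (hτT (m + 1) (by omega)) _ (hτT (m + 2) (by omega)) _
      (hτT (m + 3) (by omega)) _ (hτT l (by omega))
      (hτ _ _ (by omega) (by omega)) (hτ _ _ (by omega) (by omega)) (hτ _ _ (by omega) (by omega))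
    have p3 := hG o ho _ (hτT (m + 3) (by omega)) _ (hτT l (by omega))
      (hoT _ (by omega) (by omega)) (hτ _ _ (by omega) (by omega))
    have x1 := hXo m (by omega) (by omega)
    have x2 := hX (hτT (m + 1) (by omega)) (hτT (m + 2) (by omega)) (hτ _ _ (by omega) (by omega))
    have x3 := hX (hτT (m + 3) (by omega)) (hτT l hl) (hτ _ _ (by omega) (by omega))
    have x4 := hXo l (by omega) (by omega)
    have y3 := hY (hτT (m + 3) (by omega)) (hτT l hl) (hτ _ _ (by omega) (by omega))
    have y4 := hYo (m + 3) (by omega) (by omega)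
    have q1 : 2 * ((Y (τ m) - Y o) / (X (τ m) - X o)) ≤
        (Y (τ (m + 2)) - Y (τ (m + 1))) / (X (τ (m + 2)) - X (τ (m + 1))) := by
      rw [← mul_div_assoc, div_le_div_iff₀ x1 (by linarith)]
      linarith
    have q2 : 2 * ((Y (τ (m + 2)) - Y (τ (m + 1))) / (X (τ (m + 2)) - X (τ (m + 1)))) ≤
        (Y (τ l) - Y (τ (m + 3))) / (X (τ l) - X (τ (m + 3))) := by
      rw [← mul_div_assoc, div_le_div_iff₀ (by linarith) (by linarith)]
      linarith
    have q3 : (Y (τ l) - Y (τ (m + 3))) / (X (τ l) - X (τ (m + 3))) ≤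
        2 * ((Y (τ l) - Y o) / (X (τ l) - X o)) := by
      rw [← mul_div_assoc, div_le_div_iff₀ (by linarith) x4]
      nlinarith
    linarith
  · intro k hk
    refine ⟨hτT _ (by omega), one_pos, ?_⟩
    have := hXo (4 * (k + 1)) (by omega) (by omega)
    simp only [translateEquiv, LinearEquiv.coe_mk, LinearMap.coe_mk, AddHom.coe_mk,
      IsLacunary.pt, one_smul, mul_one, Prod.mk.injEq, true_and]
    field_simp

/-- The points behave as on a hyperbola branch. The projective map sends them to abscissa `1 / (Y -
b)` and slope `X - a`, with `a` the first abscissa and `b` the last ordinate; decay doubles the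
former and growth the latter. -/
lemma hasLacunaryChain_of_growth_decay {n : ℕ} {T : Finset ι} {X Y : ι → ℝ}
    (hX : StrictMonoOn X T) (hY : StrictAntiOn Y T) (hG : Growth T X)
    (hD : Decay T fun i => - Y i) (hT : n + 2 < T.card) :
    HasLacunaryChain n (fun i => (1, X i, Y i)) T := by
  obtain ⟨τ, hτT, hτ⟩ := T.exists_enum (Finset.card_pos.1 (by omega))
  have hXo : ∀ k, k ≤ n → 0 < X (τ (k + 1)) - X (τ 0) := fun k hk =>
    sub_pos.2 (hX (hτT _ (by omega)) (hτT _ (by omega)) (hτ _ _ (by omega) (by omega)))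
  have hYo : ∀ k, k ≤ n → 0 < Y (τ (k + 1)) - Y (τ (n + 2)) := fun k hk =>
    sub_pos.2 (hY (hτT _ (by omega)) (hτT _ (by omega)) (hτ _ _ (by omega) (by omega)))
  refine ⟨fun k => (Y (τ (k + 1)) - Y (τ (n + 2)))⁻¹, fun k => X (τ (k + 1)) - X (τ 0),
    fun k => Y (τ (k + 1)) - Y (τ (n + 2)), fun k => τ (k + 1),
    hyperbolaEquiv (X (τ 0)) (Y (τ (n + 2))), ⟨?_, hXo, ?_, ?_⟩, ?_⟩
  · exact fun k hk => inv_pos.2 (hYo k hk)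
  · intro i j hij hj
    have h1 := hYo i (by omega)
    have h2 := hYo j hj
    have := hD _ (hτT (i + 1) (by omega)) _ (hτT (j + 1) (by omega)) _ (hτT (n + 2) (by omega))
      (hτ _ _ (by omega) (by omega)) (hτ _ _ (by omega) (by omega))
    rw [← div_eq_mul_inv, div_le_iff₀ h1, inv_mul_eq_div, le_div_iff₀ h2]
    linarith
  · intro i j hij hj
    have := hG _ (hτT 0 (by omega)) _ (hτT (i + 1) (by omega)) _ (hτT (j + 1) (by omega))
      (hτ _ _ (by omega) (by omega)) (hτ _ _ (by omega) (by omega))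
    linarith
  · intro k hk
    have h1 := hYo k hk
    refine ⟨hτT _ (by omega), h1, ?_⟩
    simp only [hyperbolaEquiv, LinearEquiv.coe_mk, LinearMap.coe_mk, AddHom.coe_mk,
      IsLacunary.pt, mul_one, Prod.smul_mk, smul_eq_mul, Prod.mk.injEq, true_and]
    constructor <;> field_simp

/-- If `X` decays, reading the chain backwards gives growing abscissae and doubling slopes. If `X`
and `-Y` both grow, exchanging the axes inverts the slopes, which then double. Growth of `X` with
decay of `-Y` is the hyperbolic case. -/
lemma hasLacunaryChain_of_slopes {n m : ℕ} (hm : 4 * (n + 1) < m) {T : Finset ι} {X Y : ι → ℝ}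
    (hX : StrictMonoOn X T) (hY : StrictAntiOn Y T)
    (hS : ∀ a ∈ T, ∀ b ∈ T, ∀ c ∈ T, ∀ d ∈ T, a < b → b < c → c < d →
      2 * ((Y c - Y d) * (X b - X a)) ≤ (Y a - Y b) * (X d - X c))
    (hT : 2 ^ (2 ^ (m + m) + m) ≤ T.card) : HasLacunaryChain n (fun i => (1, X i, Y i)) T := by
  obtain ⟨U, hUT, hUc, hU⟩ | ⟨U, hUT, hUc, hU⟩ := exists_growth_or_decay _ _ T X hX hT
  · obtain ⟨W, hWU, hWc, hW⟩ | ⟨W, hWU, hWc, hW⟩ :=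
      exists_growth_or_decay m m U (fun i => - Y i)
        (fun a ha b hb hab => neg_lt_neg (hY (hUT ha) (hUT hb) hab)) hUc
    · have hWT := hWU.trans hUT
      refine HasLacunaryChain.mono (U := W) ?_ hWT
      refine HasLacunaryChain.of_equiv (v' := fun i => (1, - Y i, X i)) ?_ rotateEquiv
        fun i => rfl
      refine hasLacunaryChain_of_double
        (fun a ha b hb hab => neg_lt_neg (hY (hWT ha) (hWT hb) hab))
        (hX.mono hWT) hW ?_ (by omega)
      intro a ha b hb c hc d hd hab hbc hcd
      have := hS a (hWT ha) b (hWT hb) c (hWT hc) d (hWT hd) hab hbc hcd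
      linarith
    · have hWT := hWU.trans hUT
      exact (hasLacunaryChain_of_growth_decay (hX.mono hWT) (hY.mono hWT) (hU.mono hWU) hW
        (by omega)).mono hWT
  · refine HasLacunaryChain.mono (U := U) ?_ hUT
    refine HasLacunaryChain.of_equiv (v' := fun i => (1, - X i, Y i)) ?_ (reflectEquiv 0)
      fun i => by simp [reflectEquiv]
    refine HasLacunaryChain.of_dual ?_
    have hmem : ∀ i, i ∈ U.map OrderDual.toDual.toEmbedding → OrderDual.ofDual i ∈ U := by
      intro i hi
      obtain ⟨j, hj, rfl⟩ := Finset.mem_map.1 hi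
      exact hj
    refine hasLacunaryChain_of_double (X := fun i : ιᵒᵈ => - X (OrderDual.ofDual i))
      (Y := fun i : ιᵒᵈ => Y (OrderDual.ofDual i)) ?_ ?_ ?_ ?_ (by rw [Finset.card_map]; omega)
    · exact fun a ha b hb hab => neg_lt_neg (hX (hUT (hmem b hb)) (hUT (hmem a ha)) hab)
    · exact fun a ha b hb hab => hY (hUT (hmem b hb)) (hUT (hmem a ha)) hab
    · intro a ha b hb c hc hab hbc
      have := hU _ (hmem c hc) _ (hmem b hb) _ (hmem a ha) hbc hab
      linarith
    · intro a ha b hb c hc d hd hab hbc hcd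
      have := hS _ (hUT (hmem d hd)) _ (hUT (hmem c hc)) _ (hUT (hmem b hb)) _ (hUT (hmem a ha))
        hcd hbc hab
      linarith

end Extraction

/-- The length of a convex chain that is sufficient for `hasLacunaryChain_of_cup`. -/
def cupBound (n : ℕ) : ℕ :=
  2 ^ (2 * (2 ^ (2 ^ (2 * (4 * n + 5)) + (4 * n + 5)) + 1)) + 1

/-- The edge slopes increase, so many of them grow or decay geometrically relative to an extreme
slope `s p`. Shearing by `s p` subtracts it from all slopes; reflected in the growing case, the
chain becomes decreasing with absolute slopes that halve. The index `p` itself is dropped, hence `B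
+ 1`. -/
lemma hasLacunaryChain_of_cup {n N : ℕ} {X Y : ℕ → ℝ} (hX : ∀ i j, i < j → j < N → X i < X j)
    (hcup : ∀ a b c, a < b → b < c → c < N →
      (Y b - Y a) * (X c - X b) < (Y c - Y b) * (X b - X a))
    (hN : cupBound n ≤ N) :
    HasLacunaryChain n (fun i => (1, X i, Y i)) (Finset.range N) := by
  set m := 4 * n + 5 with hm
  obtain ⟨B, hB⟩ : ∃ B, B = 2 ^ (2 ^ (m + m) + m) := ⟨_, rfl⟩
  have hN' : 2 ^ ((B + 1) + (B + 1)) ≤ N - 1 := by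
    rw [cupBound, ← hm, two_mul m, ← hB, two_mul] at hN
    omega
  set s : ℕ → ℝ := fun k => (Y (k + 1) - Y k) / (X (k + 1) - X k) with hs
  have hXs : ∀ k, k + 1 < N → 0 < X (k + 1) - X k := fun k hk =>
    sub_pos.2 (hX _ _ (Nat.lt_succ_self k) hk)
  -- The slope of a chord lies between the slopes of the edges that start at its ends.
  have hs1 : ∀ a b, a < b → b + 1 < N → Y b - Y a ≤ s b * (X b - X a) := by
    intro a b hab hb
    have h1 := hcup a b (b + 1) hab (by omega) hb
    have h2 := hXs b hb
    rw [hs]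
    dsimp only
    rw [div_mul_eq_mul_div, le_div_iff₀ h2]
    exact h1.le
  have hs2 : ∀ a b, a < b → b < N → s a * (X b - X a) ≤ Y b - Y a := by
    intro a b hab hb
    have h2 := hXs a (by omega)
    rw [hs]
    dsimp only
    rw [div_mul_eq_mul_div, div_le_iff₀ h2]
    rcases (Nat.succ_le_of_lt hab).eq_or_lt with h | h
    · simp only [Nat.succ_eq_add_one] at h
      rw [h]
    · simp only [Nat.succ_eq_add_one] at h
      have h1 := hcup a (a + 1) b (by omega) h hb
      nlinarith
  have hsm : StrictMonoOn s (Finset.range (N - 1) : Finset ℕ) := by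
    have : ∀ a b, a < b → b + 1 < N → s a < s b := by
      intro a b hab
      induction b, hab using Nat.le_induction with
      | base =>
        intro hb
        have h1 := hcup a (a + 1) (a + 1 + 1) (by omega) (by omega) hb
        have h2 := hXs a (by omega)
        have h3 := hXs (a + 1) hb
        simp only [Nat.succ_eq_add_one]
        rw [hs]
        dsimp only
        rw [div_lt_div_iff₀ h2 h3]
        exact h1
      | succ b hb ih =>
        intro hb'
        refine (ih (by omega)).trans ?_
        have h1 := hcup b (b + 1) (b + 1 + 1) (by omega) (by omega) hb'
        have h2 := hXs b (by omega)
        have h3 := hXs (b + 1) hb'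
        rw [hs]
        dsimp only
        rw [div_lt_div_iff₀ h2 h3]
        exact h1
    intro a ha b hb hab
    rw [Finset.coe_range] at ha hb
    exact this a b hab (by have := Set.mem_Iio.1 hb; omega)
  have hrange : ∀ i, i ∈ Finset.range (N - 1) → i + 1 < N := fun i hi => by
    have := Finset.mem_range.1 hi
    omega
  have hsub : Finset.range (N - 1) ⊆ Finset.range N := Finset.range_mono (by omega)
  obtain ⟨I, hIT, hIc, hI⟩ | ⟨I, hIT, hIc, hI⟩ :=
    exists_growth_or_decay (B + 1) (B + 1) _ s hsm (by rwa [Finset.card_range])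
  · have hne : I.Nonempty := Finset.card_pos.1 (by omega)
    set p := I.min' hne
    have hpI : p ∈ I := I.min'_mem hne
    have hlt : ∀ i ∈ I.erase p, p < i := fun i hi =>
      lt_of_le_of_ne (I.min'_le _ (Finset.mem_of_mem_erase hi)) (Finset.ne_of_mem_erase hi).symm
    have hN2 : ∀ i ∈ I, i + 1 < N := fun i hi => hrange i (hIT hi)
    refine HasLacunaryChain.mono (U := I.erase p) ?_
      ((Finset.erase_subset _ _).trans (hIT.trans hsub))
    refine HasLacunaryChain.of_equiv (v' := fun i => (1, - X i, Y i - s p * X i)) ?_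
      (reflectEquiv (s p)) fun i => rfl
    refine HasLacunaryChain.of_dual ?_
    have hmem : ∀ i, i ∈ (I.erase p).map OrderDual.toDual.toEmbedding →
        OrderDual.ofDual i ∈ I ∧ p < OrderDual.ofDual i := by
      intro i hi
      obtain ⟨j, hj, rfl⟩ := Finset.mem_map.1 hi
      exact ⟨Finset.mem_of_mem_erase hj, hlt j hj⟩
    refine hasLacunaryChain_of_slopes (m := m) (by omega)
      (X := fun i : ℕᵒᵈ => - X (OrderDual.ofDual i))
      (Y := fun i : ℕᵒᵈ => Y (OrderDual.ofDual i) - s p * X (OrderDual.ofDual i)) ?_ ?_ ?_ ?_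
    · intro a ha b hb hab
      exact neg_lt_neg (hX _ _ hab (by have := hN2 _ (hmem a ha).1; omega))
    · intro b hb a ha hab
      obtain ⟨hb, hpb⟩ := hmem b hb
      obtain ⟨ha, hpa⟩ := hmem a ha
      have hab : OrderDual.ofDual a < OrderDual.ofDual b := hab
      have h1 := hsm (hIT hpI) (hIT ha) hpa
      have h2 := hX _ _ hab (by have := hN2 _ hb; omega)
      have h3 := hs2 _ _ hab (by have := hN2 _ hb; omega)
      have h4 := mul_pos (sub_pos.2 h1) (sub_pos.2 h2)
      dsimp only
      nlinarith
    · intro a ha b hb c hc d hd hab hbc hcd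
      obtain ⟨ha, hpa⟩ := hmem a ha
      obtain ⟨hb, hpb⟩ := hmem b hb
      obtain ⟨hc, hpc⟩ := hmem c hc
      obtain ⟨hd, hpd⟩ := hmem d hd
      have hba : OrderDual.ofDual b < OrderDual.ofDual a := hab
      have hcb : OrderDual.ofDual c < OrderDual.ofDual b := hbc
      have hdc : OrderDual.ofDual d < OrderDual.ofDual c := hcd
      have h1 := hs2 _ _ hba (by have := hN2 _ ha; omega)
      have h2 := hs1 _ _ hdc (hN2 _ hc)
      have h3 := hI p hpI _ hc _ hb hpc hcb
      have h4 := sub_pos.2 (hX _ _ hba (by have := hN2 _ ha; omega))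
      have h5 := sub_pos.2 (hX _ _ hdc (by have := hN2 _ hc; omega))
      have h6 := mul_le_mul_of_nonneg_right h3 (mul_pos h4 h5).le
      nlinarith
    · rw [Finset.card_map, Finset.card_erase_of_mem hpI, ← hB]
      omega
  · have hne : I.Nonempty := Finset.card_pos.1 (by omega)
    set p := I.max' hne
    have hpI : p ∈ I := I.max'_mem hne
    have hmem : ∀ i ∈ I.erase p, i ∈ I ∧ i < p := fun i hi =>
      ⟨Finset.mem_of_mem_erase hi,
        lt_of_le_of_ne (I.le_max' _ (Finset.mem_of_mem_erase hi)) (Finset.ne_of_mem_erase hi)⟩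
    have hN2 : ∀ i ∈ I, i + 1 < N := fun i hi => hrange i (hIT hi)
    refine HasLacunaryChain.mono (U := I.erase p) ?_
      ((Finset.erase_subset _ _).trans (hIT.trans hsub))
    refine HasLacunaryChain.of_equiv (v' := fun i => (1, X i, Y i - s p * X i)) ?_
      (shearEquiv (s p)) fun i => rfl
    refine hasLacunaryChain_of_slopes (m := m) (by omega) ?_ ?_ ?_ ?_
    · intro a ha b hb hab
      exact hX _ _ hab (by have := hN2 _ (hmem b hb).1; omega)
    · intro a ha b hb hab
      obtain ⟨hb, hpb⟩ := hmem b hb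
      have h1 := hsm (hIT hb) (hIT hpI) hpb
      have h2 := hX _ _ hab (by have := hN2 _ hb; omega)
      have h3 := hs1 _ _ hab (hN2 _ hb)
      have h4 := mul_pos (sub_pos.2 h1) (sub_pos.2 h2)
      dsimp only
      nlinarith
    · intro a ha b hb c hc d hd hab hbc hcd
      obtain ⟨ha, hpa⟩ := hmem a ha
      obtain ⟨hb, hpb⟩ := hmem b hb
      obtain ⟨hc, hpc⟩ := hmem c hc
      obtain ⟨hd, hpd⟩ := hmem d hd
      have h1 := hs1 _ _ hab (hN2 _ hb)
      have h2 := hs2 _ _ hcd (by have := hN2 _ hd; omega)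
      have h3 := hI _ hb _ hc p hpI hbc hpc
      have h4 := sub_pos.2 (hX _ _ hab (by have := hN2 _ hb; omega))
      have h5 := sub_pos.2 (hX _ _ hcd (by have := hN2 _ hd; omega))
      have h6 := mul_le_mul_of_nonneg_right h3 (mul_pos h4 h5).le
      nlinarith
    · rw [Finset.card_erase_of_mem hpI, ← hB]
      omega

/-! ### Lacunary chains in polygons, and removal of chains -/

lemma zero_mem_coneOver {s : Set (Fin 2 → ℝ)} : (0 : ℝ × (Fin 2 → ℝ)) ∈ coneOver s :=
  Submodule.zero_mem (PointedCone.hull ℝ ((fun p => ((1 : ℝ), p)) '' s))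

lemma HasConeLift.coneOver_subset {C : Set (ℝ × (Fin 2 → ℝ))} {r : ℕ} (h : HasConeLift C r)
    {s : Set (Fin 2 → ℝ)} (hs : ∀ p ∈ s, ((1 : ℝ), p) ∈ C) : coneOver s ⊆ C := by
  obtain ⟨K, rfl⟩ := h.exists_pointedCone
  refine Submodule.span_le.2 ?_
  rintro _ ⟨p, hp, rfl⟩
  exact hs p hp

lemma HasLacunaryChain.of_comp {ι κ : Type*} {n : ℕ} {v : ι → ℝ × ℝ × ℝ} {T : Finset ι}
    {S : Finset κ} (ρ : κ → ι) (hρ : ∀ k ∈ S, ρ k ∈ T)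
    (h : HasLacunaryChain n (fun k => v (ρ k)) S) : HasLacunaryChain n v T := by
  obtain ⟨x, r, c, q, e, hl, hq⟩ := h
  exact ⟨x, r, c, fun k => ρ (q k), e, hl, fun k hk => ⟨hρ _ (hq k hk).1, (hq k hk).2⟩⟩

/-- Of points in convex position, those below the chord between the extreme ones form a convex
chain. -/
lemma cup_of_below_chord {V : Finset (Fin 2 → ℝ)}
    (hV : ∀ p ∈ V, p ∉ convexHull ℝ ((V : Set (Fin 2 → ℝ)) \ {p}))
    {f g : (Fin 2 → ℝ) →ₗ[ℝ] ℝ} (hfg : ∀ p, f p = 0 → g p = 0 → p = 0)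
    {a b c o l : Fin 2 → ℝ} (ha : a ∈ V) (hb : b ∈ V) (hc : c ∈ V) (ho : o ∈ V) (hl : l ∈ V)
    (hoa : f o < f a) (hab : f a < f b) (hbc : f b < f c) (hcl : f c < f l)
    (hbelow : (g b - g o) * (f l - f o) ≤ (g l - g o) * (f b - f o)) :
    (g b - g a) * (f c - f b) < (g c - g b) * (f b - f a) := by
  -- Otherwise `b` lies on or above the segment from `a` to `c` and on or below that from `o` to
  -- `l`, hence between points `m1` and `m2` of these segments with the same abscissa, inside the
  -- hull of the others.
  by_contra! hcon
  refine hV b hb ?_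
  set H := convexHull ℝ ((V : Set (Fin 2 → ℝ)) \ {b})
  have hH : ∀ p ∈ V, f p ≠ f b → p ∈ H := fun p hp hne =>
    subset_convexHull ℝ _ ⟨hp, fun h => hne (by rw [Set.mem_singleton_iff.1 h])⟩
  have hcomb : ∀ (w : ℝ) (p q : Fin 2 → ℝ), 0 ≤ w → w ≤ 1 → p ∈ H → q ∈ H →
      (1 - w) • p + w • q ∈ H := fun w p q h0 h1 hp hq =>
    convex_convexHull ℝ _ hp hq (by linarith) h0 (by ring)
  set u := (f b - f a) / (f c - f a) with hu
  have hu' : u * (f c - f a) = f b - f a := div_mul_cancel₀ _ (by linarith)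
  set v := (f b - f o) / (f l - f o) with hv
  have hv' : v * (f l - f o) = f b - f o := div_mul_cancel₀ _ (by linarith)
  have m1H := hcomb u a c (div_nonneg (by linarith) (by linarith))
    (by rw [hu, div_le_one (by linarith)]; linarith) (hH a ha hab.ne) (hH c hc hbc.ne')
  have m2H := hcomb v o l (div_nonneg (by linarith) (by linarith))
    (by rw [hv, div_le_one (by linarith)]; linarith) (hH o ho (hoa.trans hab).ne)
    (hH l hl (hbc.trans hcl).ne')
  set m1 := (1 - u) • a + u • c with hm1
  set m2 := (1 - v) • o + v • l with hm2
  have f1 : f m1 = f b := by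
    simp only [hm1, map_add, map_smul, smul_eq_mul]; linarith
  have f2 : f m2 = f b := by
    simp only [hm2, map_add, map_smul, smul_eq_mul]; linarith
  have g1 : g m1 ≤ g b := by
    have h1 : (g m1 - g b) * (f c - f a) =
        (g c - g b) * (f b - f a) - (g b - g a) * (f c - f b) := by
      simp only [hm1, map_add, map_smul, smul_eq_mul]
      linear_combination (g c - g a) * hu'
    have h2 : 0 < f c - f a := by linarith
    by_contra! h3
    have := mul_pos (sub_pos.2 h3) h2
    linarith
  have g2 : g b ≤ g m2 := by
    have h1 : (g m2 - g b) * (f l - f o) =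
        (g l - g o) * (f b - f o) - (g b - g o) * (f l - f o) := by
      simp only [hm2, map_add, map_smul, smul_eq_mul]
      linear_combination (g l - g o) * hv'
    have h2 : 0 < f l - f o := by linarith
    by_contra! h3
    have := mul_pos (sub_pos.2 h3) h2
    linarith
  have heq : ∀ z, f z = f b → g z = g b → z = b := fun z h1 h2 =>
    sub_eq_zero.1 (hfg _ (by rw [map_sub, h1, sub_self]) (by rw [map_sub, h2, sub_self]))
  rcases (g1.trans g2).eq_or_lt with h | h
  · rw [← heq m1 f1 (by linarith)]
    exact m1H
  · have hw := hcomb ((g b - g m1) / (g m2 - g m1)) m1 m2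
      (div_nonneg (by linarith) (by linarith)) (by rw [div_le_one (by linarith)]; linarith) m1H m2H
    have hgm : g m2 - g m1 ≠ 0 := by linarith
    have e := heq ((1 - (g b - g m1) / (g m2 - g m1)) • m1 +
        ((g b - g m1) / (g m2 - g m1)) • m2)
      (by simp only [map_add, map_smul, smul_eq_mul, f1, f2]; ring)
      (by simp only [map_add, map_smul, smul_eq_mul]; field_simp; ring)
    rw [e] at hw
    exact hw

/-- The change of coordinates given by a linear form `(a, b) ≠ 0` on the plane and a multiple of
its rotation. -/
noncomputable def similarityEquiv (a b ε : ℝ) (h : a ^ 2 + b ^ 2 ≠ 0) (hε : ε ^ 2 = 1) :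
    (ℝ × ℝ × ℝ) ≃ₗ[ℝ] ℝ × ℝ × ℝ where
  toFun z := (z.1, a * z.2.1 + b * z.2.2, ε * (a * z.2.2 - b * z.2.1))
  invFun z := (z.1, (a * z.2.1 - b * (ε * z.2.2)) / (a ^ 2 + b ^ 2),
    (b * z.2.1 + a * (ε * z.2.2)) / (a ^ 2 + b ^ 2))
  map_add' z w := by ext <;> simp <;> ring
  map_smul' c z := by ext <;> simp <;> ring
  left_inv z := by
    ext
    · simp
    · simp only
      field_simp
      linear_combination (-(b * (a * z.2.2 - b * z.2.1))) * hε
    · simp only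
      field_simp
      linear_combination (a * (a * z.2.2 - b * z.2.1)) * hε
  right_inv z := by
    ext
    · simp
    · simp only
      field_simp
      ring
    · simp only
      field_simp
      linear_combination z.2.2 * (a ^ 2 + b ^ 2) * hε

/-- The number of points in convex position that is sufficient for
`hasLacunaryChain_of_convexIndependent`. -/
def polygonBound (n : ℕ) : ℕ := 2 * cupBound n + 2

/-- A linear form injective on `V` serves as abscissa. Of the points strictly between the two
extreme ones, `cupBound n` lie on one side of the chord joining these; the sign `ε` turns that side
downwards. -/
lemma hasLacunaryChain_of_convexIndependent {n : ℕ} {V : Finset (Fin 2 → ℝ)}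
    (hV : ∀ p ∈ V, p ∉ convexHull ℝ ((V : Set (Fin 2 → ℝ)) \ {p}))
    (hcard : polygonBound n ≤ V.card) :
    HasLacunaryChain n (fun p : Fin 2 → ℝ => (1, p 0, p 1)) V := by
  have hc0 : 0 < cupBound n := Nat.succ_pos _
  rw [polygonBound] at hcard
  obtain ⟨f, hf⟩ := Module.exists_dual_forall_apply_ne_zero (K := ℝ)
    (fun i : {i : V × V // i.1 ≠ i.2} => (i.1.1 : Fin 2 → ℝ) - i.1.2)
    (fun i => sub_ne_zero.2 fun h => i.2 (Subtype.ext h))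
  have hinj : Set.InjOn f V := by
    intro p hp q hq hpq
    by_contra hne
    refine hf ⟨(⟨p, hp⟩, ⟨q, hq⟩), fun h => hne (congrArg Subtype.val h)⟩ ?_
    rw [map_sub, sub_eq_zero]
    exact hpq
  set α := f (Pi.single 0 1) with hα
  set β := f (Pi.single 1 1) with hβ
  have hfapp : ∀ p, f p = α * p 0 + β * p 1 := by
    intro p
    have : p = p 0 • Pi.single 0 1 + p 1 • Pi.single 1 1 := by
      ext i
      fin_cases i <;> simp
    conv_lhs => rw [this]
    rw [map_add, map_smul, map_smul, smul_eq_mul, smul_eq_mul, hα, hβ]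
    ring
  have hαβ : α ^ 2 + β ^ 2 ≠ 0 := by
    intro h0
    have h1 : α = 0 := by nlinarith [sq_nonneg α, sq_nonneg β]
    have h2 : β = 0 := by nlinarith [sq_nonneg α, sq_nonneg β]
    obtain ⟨p, hp, q, hq, hpq⟩ := Finset.one_lt_card.1 (show 1 < V.card by omega)
    exact hpq (hinj hp hq (by rw [hfapp, hfapp, h1, h2]; ring))
  set M := (V.image f).card with hM
  have hMV : M = V.card := Finset.card_image_of_injOn hinj
  obtain ⟨τ, hτV, hτ⟩ := (V.image f).exists_enum (Finset.card_pos.1 (by omega))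
  have hq : ∀ k, ∃ p, k < M → p ∈ V ∧ f p = τ k := by
    intro k
    by_cases hk : k < M
    · obtain ⟨p, hp, hpk⟩ := Finset.mem_image.1 (hτV k hk)
      exact ⟨p, fun _ => ⟨hp, hpk⟩⟩
    · exact ⟨0, fun h => absurd h hk⟩
  choose q hq using hq
  have hqV : ∀ k, k < M → q k ∈ V := fun k hk => (hq k hk).1
  have hfq : ∀ i j, i < j → j < M → f (q i) < f (q j) := by
    intro i j hij hj
    rw [(hq i (hij.trans hj)).2, (hq j hj).2]
    exact hτ i j hij hj
  -- the chain below the chord, for either orientation of the second coordinate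
  have main : ∀ ε : ℝ, ε ^ 2 = 1 → ∀ S : Finset ℕ, (∀ k ∈ S, 0 < k ∧ k < M - 1 ∧
      ε * (((α * q k 1 - β * q k 0) - (α * q 0 1 - β * q 0 0)) * (f (q (M - 1)) - f (q 0)) -
        ((α * q (M - 1) 1 - β * q (M - 1) 0) - (α * q 0 1 - β * q 0 0)) *
          (f (q k) - f (q 0))) ≤ 0) → cupBound n ≤ S.card →
      HasLacunaryChain n (fun p : Fin 2 → ℝ => (1, p 0, p 1)) V := by
    intro ε hε S hS hSc
    obtain ⟨σ, hσS, hσ⟩ := S.exists_enum (Finset.card_pos.1 (by omega))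
    let g : (Fin 2 → ℝ) →ₗ[ℝ] ℝ := (ε * α) • LinearMap.proj 1 - (ε * β) • LinearMap.proj 0
    have hg : ∀ p, g p = ε * (α * p 1 - β * p 0) := fun p => by
      simp [g]; ring
    have hfg : ∀ p, f p = 0 → g p = 0 → p = 0 := by
      intro p h1 h2
      rw [hfapp] at h1
      rw [hg] at h2
      have h3 : α * p 1 - β * p 0 = 0 := by
        linear_combination ε * h2 - (α * p 1 - β * p 0) * hε
      ext i
      refine (mul_eq_zero.1 (?_ : (α ^ 2 + β ^ 2) * p i = 0)).resolve_left hαβ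
      fin_cases i
      · change (α ^ 2 + β ^ 2) * p 0 = 0
        linear_combination α * h1 - β * h3
      · change (α ^ 2 + β ^ 2) * p 1 = 0
        linear_combination β * h1 + α * h3
    have hσM : ∀ k, k < S.card → 0 < σ k ∧ σ k < M - 1 := fun k hk =>
      ⟨(hS _ (hσS k hk)).1, (hS _ (hσS k hk)).2.1⟩
    refine HasLacunaryChain.of_equiv (v' := fun p => (1, f p, g p)) ?_
      (similarityEquiv α β ε hαβ hε) (fun p => by simp [similarityEquiv, hfapp, hg])
    refine HasLacunaryChain.of_comp (S := Finset.range S.card) (fun k => q (σ k)) ?_ ?_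
    · intro k hk
      have := (hσM k (Finset.mem_range.1 hk)).2
      exact hqV _ (by omega)
    · refine hasLacunaryChain_of_cup (X := fun k => f (q (σ k))) (Y := fun k => g (q (σ k)))
        ?_ ?_ hSc
      · intro i j hij hj
        have := (hσM j hj).2
        exact hfq _ _ (hσ i j hij hj) (by omega)
      · intro a b c hab hbc hc
        have hb := hbc.trans hc
        have ha := hab.trans hb
        have h1 := hσM a ha
        have h2 := hσM b hb
        have h3 := hσM c hc
        refine cup_of_below_chord hV hfg (o := q 0) (l := q (M - 1)) (hqV _ (by omega))
          (hqV _ (by omega)) (hqV _ (by omega)) (hqV _ (by omega)) (hqV _ (by omega))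
          (hfq _ _ h1.1 (by omega)) (hfq _ _ (hσ _ _ hab hb) (by omega))
          (hfq _ _ (hσ _ _ hbc hc) (by omega)) (hfq _ _ h3.2 (by omega)) ?_
        have h4 := (hS _ (hσS b hb)).2.2
        rw [hg, hg, hg]
        linarith
  set D : ℕ → ℝ := fun k =>
    ((α * q k 1 - β * q k 0) - (α * q 0 1 - β * q 0 0)) * (f (q (M - 1)) - f (q 0)) -
      ((α * q (M - 1) 1 - β * q (M - 1) 0) - (α * q 0 1 - β * q 0 0)) * (f (q k) - f (q 0))
    with hD
  have hsplit := Finset.card_filter_add_card_filter_not (s := Finset.Ioo 0 (M - 1))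
    (fun k => D k ≤ 0)
  rw [Nat.card_Ioo] at hsplit
  rcases le_or_gt (cupBound n) ((Finset.Ioo 0 (M - 1)).filter fun k => D k ≤ 0).card with h | h
  · refine main 1 (by norm_num) _ (fun k hk => ?_) h
    obtain ⟨h1, h2⟩ := Finset.mem_filter.1 hk
    rw [Finset.mem_Ioo] at h1
    exact ⟨h1.1, h1.2, by rw [one_mul]; exact h2⟩
  · refine main (-1) (by norm_num) ((Finset.Ioo 0 (M - 1)).filter fun k => ¬ D k ≤ 0)
      (fun k hk => ?_) (by omega)
    obtain ⟨h1, h2⟩ := Finset.mem_filter.1 hk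
    rw [Finset.mem_Ioo] at h1
    refine ⟨h1.1, h1.2, ?_⟩
    rw [neg_one_mul]
    exact neg_nonpos.2 (not_le.1 h2).le

/-- Coordinates of the plane at height one. -/
def planeEquiv : (ℝ × (Fin 2 → ℝ)) ≃ₗ[ℝ] ℝ × ℝ × ℝ where
  toFun z := (z.1, z.2 0, z.2 1)
  invFun z := (z.1, ![z.2.1, z.2.2])
  map_add' z w := rfl
  map_smul' c z := rfl
  left_inv z := by
    ext i
    · rfl
    · fin_cases i <;> rfl
  right_inv z := rfl

/-- Transport by the linear change of coordinates; the positive factors `c k` do not matter to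
cones. -/
lemma HasLacunaryChain.exists_hasConeLift {s : ℕ} (hs : 0 < s) {V : Finset (Fin 2 → ℝ)}
    (h : HasLacunaryChain (s * (s + 2)) (fun p : Fin 2 → ℝ => (1, p 0, p 1)) V) :
    ∃ W ⊆ V, W.card = s * (s + 1) ∧ ∃ C : Set (ℝ × (Fin 2 → ℝ)), HasConeLift C (4 * s) ∧
      (∀ p ∈ W, ((1 : ℝ), p) ∈ C) ∧ C ⊆ coneOver V := by
  obtain ⟨x, r, c, q, e, hl, hq⟩ := h
  obtain ⟨J, hJ, hJc, C, hC, hJC, hCsub⟩ := hl.exists_hasConeLift hs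
  obtain ⟨K, hK⟩ := hC.exists_pointedCone
  let Φ := planeEquiv.trans e
  have hΦ : ∀ k, k ≤ s * (s + 2) → Φ (1, q k) = c k • IsLacunary.pt x r k := fun k hk =>
    (hq k hk).2.2
  refine ⟨J.image q, ?_, ?_, Φ.symm '' C, hC.map Φ.symm, ?_, ?_⟩
  · intro p hp
    obtain ⟨j, hj, rfl⟩ := Finset.mem_image.1 hp
    exact (hq j (hJ j hj)).1
  · rw [Finset.card_image_of_injOn, hJc]
    intro i hi j hj hij
    have hi := hJ i hi
    have hj := hJ j hj
    have h1 := hΦ i hi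
    rw [hij, hΦ j hj] at h1
    simp only [IsLacunary.pt, Prod.smul_mk, smul_eq_mul, mul_one, Prod.mk.injEq] at h1
    have h2 := (hq i hi).2.1
    have h3 : x j = x i := by
      have := h1.2.1
      rw [h1.1] at this
      exact mul_left_cancel₀ h2.ne' this
    rcases lt_trichotomy i j with h4 | h4 | h4
    · have := hl.x_lt h4 hj
      linarith
    · exact h4
    · have := hl.x_lt h4 hi
      linarith
  · intro p hp
    obtain ⟨j, hj, rfl⟩ := Finset.mem_image.1 hp
    refine ⟨Φ (1, q j), ?_, Φ.symm_apply_apply _⟩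
    rw [hΦ j (hJ j hj), ← hK]
    have h1 : IsLacunary.pt x r j ∈ K := by
      rw [← SetLike.mem_coe, hK]
      exact hJC j hj
    exact K.smul_mem (hq j (hJ j hj)).2.1.le h1
  · rintro _ ⟨z, hz, rfl⟩
    refine Submodule.span_induction (p := fun z _ => Φ.symm z ∈ coneOver (V : Set (Fin 2 → ℝ)))
      ?_ ?_ ?_ ?_ (hCsub hz)
    · rintro _ ⟨j, hj, rfl⟩
      have h1 : IsLacunary.pt x r j = (c j)⁻¹ • Φ (1, q j) := by
        rw [hΦ j hj, smul_smul, inv_mul_cancel₀ (hq j hj).2.1.ne', one_smul]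
      rw [h1, map_smul, Φ.symm_apply_apply]
      exact smul_mem_coneOver (inv_nonneg.2 (hq j hj).2.1.le) (pair_mem_coneOver (hq j hj).1)
    · rw [map_zero]
      exact Submodule.zero_mem (PointedCone.hull ℝ ((fun p => ((1 : ℝ), p)) '' _))
    · intro y z _ _ hy hz
      rw [map_add]
      exact add_mem_coneOver hy hz
    · rintro ⟨a, ha⟩ z _ hz
      have : Φ.symm ((⟨a, ha⟩ : {a : ℝ // 0 ≤ a}) • z) = a • Φ.symm z := map_smul Φ.symm a z
      rw [this]
      exact smul_mem_coneOver ha hz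

/-- The cone over a set in convex position has a lift with few inequalities. -/
theorem exists_hasConeLift_coneOver {s : ℕ} (hs : 0 < s) (V : Finset (Fin 2 → ℝ))
    (hV : ∀ p ∈ V, p ∉ convexHull ℝ ((V : Set (Fin 2 → ℝ)) \ {p})) :
    ∃ r : ℕ, r * (s + 1) ≤ 4 * V.card + (s + 1) * polygonBound (s * (s + 2)) ∧
      HasConeLift (coneOver (V : Set (Fin 2 → ℝ))) r := by
  classical
  induction hn : V.card using Nat.strong_induction_on generalizing V with
  | _ n ih =>
  subst hn
  -- Each round removes `s * (s + 1)` points for `4 * s` inequalities, a price of `4 / (s + 1)` per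
  -- point, until fewer than the polygon bound remain.
  rcases lt_or_ge V.card (polygonBound (s * (s + 2))) with hlt | hge
  · refine ⟨V.card, ?_, hasConeLift_coneOver_finset V⟩
    have := Nat.mul_le_mul_left (s + 1) hlt.le
    rw [mul_comm]
    omega
  · obtain ⟨W, hWV, hWc, C, hC, hWC, hCV⟩ :=
      (hasLacunaryChain_of_convexIndependent hV hge).exists_hasConeLift hs
    have hcard : (V \ W).card + s * (s + 1) = V.card := by
      rw [← hWc]
      exact Finset.card_sdiff_add_card_eq_card hWV
    have hpos : 0 < s * (s + 1) := by positivity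
    have hsub : V \ W ⊆ V := Finset.sdiff_subset
    obtain ⟨r, hr, hlift⟩ := ih _ (by omega) (V \ W) (fun p hp hmem => hV p (hsub hp)
      (convexHull_mono (Set.sdiff_subset_sdiff_left (Finset.coe_subset.2 hsub)) hmem)) rfl
    have hτ : ∀ z ∈ coneOver (V : Set (Fin 2 → ℝ)), z ≠ 0 →
        0 < LinearMap.fst ℝ ℝ (Fin 2 → ℝ) z := fun z hz hne =>
      ((mem_coneOver_cases hz).resolve_left hne).1
    have hsub' : coneOver ((V \ W : Finset (Fin 2 → ℝ)) : Set (Fin 2 → ℝ)) ⊆ coneOver V :=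
      coneOver_mono (Finset.coe_subset.2 hsub)
    have hadd := hC.add hlift (LinearMap.fst ℝ ℝ (Fin 2 → ℝ)) (fun z hz => hτ z (hCV hz))
      (fun z hz => hτ z (hsub' hz))
    refine ⟨4 * s + r, by nlinarith, ?_⟩
    have h0 : (0 : ℝ × (Fin 2 → ℝ)) ∈ C := by
      obtain ⟨K, hK⟩ := hC.exists_pointedCone
      rw [← hK]
      exact K.zero_mem
    -- `C` need not be the cone over `W`: it suffices that it contains `W` and stays inside the cone
    -- over `V`.
    have heq : {z | ∃ x ∈ C, ∃ y ∈ coneOver ((V \ W : Finset (Fin 2 → ℝ)) : Set (Fin 2 → ℝ)),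
        z = x + y} = coneOver (V : Set (Fin 2 → ℝ)) := by
      apply subset_antisymm
      · rintro _ ⟨x, hx, y, hy, rfl⟩
        exact add_mem_coneOver (hCV hx) (hsub' hy)
      · refine hadd.coneOver_subset fun p hp => ?_
        by_cases hpW : p ∈ W
        · exact ⟨((1 : ℝ), p), hWC p hpW, 0, zero_mem_coneOver, (add_zero ((1 : ℝ), p)).symm⟩
        · have hp' : ((1 : ℝ), p) ∈
              coneOver ((V \ W : Finset (Fin 2 → ℝ)) : Set (Fin 2 → ℝ)) :=
            pair_mem_coneOver (Finset.mem_coe.2 (Finset.mem_sdiff.2 ⟨hp, hpW⟩))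
          exact ⟨0, h0, ((1 : ℝ), p), hp', (zero_add ((1 : ℝ), p)).symm⟩
    rw [← heq]
    exact hadd

/-! ### Sublinear extensions of polygons -/

/-- Every convex `n`-gon has an extension with at most `r` facets. -/
def PolygonsHaveExtension (n r : ℕ) : Prop :=
  ∀ P : Set (Fin 2 → ℝ), IsConvexPolygon n P →
    ∃ (d : ℕ) (Q : Set (Fin d → ℝ)) (π : (Fin d → ℝ) →ₗ[ℝ] (Fin 2 → ℝ)),
      IsExtension P Q π ∧ numFacets Q ≤ (r : ℕ∞)

lemma polygonsHaveExtension_self (n : ℕ) : PolygonsHaveExtension n n := by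
  rintro _ ⟨-, V, rfl, -, rfl⟩
  exact exists_isExtension_of_hasConeLift (hasConeLift_coneOver_finset V)

lemma polygonsHaveExtension_div {s : ℕ} (hs : 0 < s) (n : ℕ) :
    PolygonsHaveExtension n (4 * n / (s + 1) + polygonBound (s * (s + 2))) := by
  rintro _ ⟨-, V, rfl, hV, rfl⟩
  obtain ⟨r, hr, hl⟩ := exists_hasConeLift_coneOver hs V fun p hp =>
    convexIndependent_set_iff_notMem_convexHull_sdiff (𝕜 := ℝ) (s := (V : Set (Fin 2 → ℝ))).1
      hV p (Finset.mem_coe.2 hp)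
  obtain ⟨d, Q, π, hQ, hle⟩ := exists_isExtension_of_hasConeLift hl
  refine ⟨d, Q, π, hQ, hle.trans ?_⟩
  have : r ≤ (4 * V.card + (s + 1) * polygonBound (s * (s + 2))) / (s + 1) :=
    (Nat.le_div_iff_mul_le (by omega)).2 hr
  rw [Nat.add_mul_div_left _ _ (by omega)] at this
  exact_mod_cast this

lemma PolygonsHaveExtension.extensionComplexity_le {n r : ℕ} (h : PolygonsHaveExtension n r)
    {P : Set (Fin 2 → ℝ)} (hP : IsConvexPolygon n P) : extensionComplexity P ≤ (r : ℕ∞) := by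
  obtain ⟨d, Q, π, hQ, hr⟩ := h P hP
  exact iInf_le_of_le d (iInf_le_of_le Q (iInf_le_of_le π (iInf_le_of_le hQ hr)))

/-- The least number of facets that suffices for extensions of all convex `n`-gons. -/
noncomputable def polygonFacetNumber (n : ℕ) : ℕ :=
  sInf {r : ℕ | PolygonsHaveExtension n r}

lemma polygonsHaveExtension_polygonFacetNumber (n : ℕ) :
    PolygonsHaveExtension n (polygonFacetNumber n) :=
  Nat.sInf_mem (s := {r : ℕ | PolygonsHaveExtension n r}) ⟨n, polygonsHaveExtension_self n⟩

lemma polygonFacetNumber_isLittleO :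
    (fun n : ℕ => (polygonFacetNumber n : ℝ)) =o[atTop] (fun n : ℕ => (n : ℝ)) := by
  rw [isLittleO_iff]
  intro c hc
  -- This makes `4 / (s + 1)` at most `c / 2`; the other half of `c` absorbs the constant for large
  -- `n`.
  obtain ⟨s, hs⟩ := exists_nat_gt (8 / c)
  have hs0 : 0 < s := by
    have : (0 : ℝ) < s := (by positivity : 0 < 8 / c).trans hs
    exact_mod_cast this
  rw [div_lt_iff₀ hc] at hs
  obtain ⟨n₀, hn₀⟩ := exists_nat_gt (2 * (polygonBound (s * (s + 2)) : ℝ) / c)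
  rw [div_lt_iff₀ hc] at hn₀
  filter_upwards [eventually_ge_atTop n₀] with n hn
  have hle : polygonFacetNumber n ≤ 4 * n / (s + 1) + polygonBound (s * (s + 2)) :=
    Nat.sInf_le (polygonsHaveExtension_div hs0 n)
  have hle' : (polygonFacetNumber n : ℝ) ≤
      4 * n / (s + 1) + (polygonBound (s * (s + 2)) : ℝ) := by
    refine (Nat.cast_le.2 hle).trans ?_
    push_cast
    gcongr
    exact (Nat.cast_div_le).trans (by push_cast; rfl)
  have h1 : (4 * n / (s + 1) : ℝ) ≤ c / 2 * n := by
    rw [div_le_iff₀ (by positivity)]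
    have : (0 : ℝ) ≤ n := n.cast_nonneg
    nlinarith [mul_nonneg this hc.le, mul_nonneg this (sub_nonneg.2 hs.le)]
  have h2 : (n₀ : ℝ) * c ≤ n * c := by gcongr
  rw [Real.norm_natCast, Real.norm_natCast]
  linarith

/-- Convex polygons do not need linearly many inequalities. -/
lemma not_frequently_linear_extensionComplexity :
    ¬ ∃ c : ℝ, 0 < c ∧ ∃ᶠ n : ℕ in atTop, ∃ P : Set (Fin 2 → ℝ),
      IsConvexPolygon n P ∧
        ENNReal.ofReal (c * (n : ℝ)) ≤ (extensionComplexity P : ℝ≥0∞) := by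
  rintro ⟨c, hc, hfreq⟩
  refine hfreq ?_
  filter_upwards [(isLittleO_iff.1 polygonFacetNumber_isLittleO) (half_pos hc),
    eventually_gt_atTop 0] with n hn hpos
  rintro ⟨P, hP, hle⟩
  have h1 := (polygonsHaveExtension_polygonFacetNumber n).extensionComplexity_le hP
  have h2 : ENNReal.ofReal (c * n) ≤ ENNReal.ofReal (polygonFacetNumber n : ℝ) := by
    rw [ENNReal.ofReal_natCast]
    refine hle.trans ?_
    exact_mod_cast ENat.toENNReal_le.2 h1
  rw [ENNReal.ofReal_le_ofReal_iff (Nat.cast_nonneg _)] at h2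
  rw [Real.norm_natCast, Real.norm_natCast] at hn
  have : (0 : ℝ) < n := by exact_mod_cast hpos
  nlinarith [mul_pos hc this]

/-! ### The explicit bound with six logarithms -/

lemma two_pow_le_exp (k : ℕ) : (2 : ℝ) ^ k ≤ Real.exp k := by
  have h : (2 : ℝ) ≤ Real.exp 1 := by linarith [Real.add_one_le_exp (1 : ℝ)]
  calc (2 : ℝ) ^ k ≤ Real.exp 1 ^ k := by gcongr
    _ = Real.exp k := by rw [← Real.exp_nat_mul, mul_one]

lemma two_pow_le_exp_of_le {k : ℕ} {x : ℝ} (h : (k : ℝ) ≤ x) : (2 : ℝ) ^ k ≤ Real.exp x :=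
  (two_pow_le_exp k).trans (Real.exp_le_exp.2 h)

lemma mul_le_exp_of_le {x : ℝ} (hx : 40 ≤ x) : 20 * x ≤ Real.exp x := by
  nlinarith [Real.quadratic_le_exp_of_nonneg (x := x) (by linarith)]

/-- The polygon bound is dominated by a sixfold exponential. -/
lemma polygonBound_mul_le {n : ℕ} {L : ℝ} (hL : 40 ≤ L) (hn : (n + 1 : ℝ) ≤ L) :
    (polygonBound n : ℝ) * L ≤ Real.exp (Real.exp (Real.exp (Real.exp (Real.exp
      (Real.exp L))))) := by
  -- The polygon bound contains three nested powers of two, which are matched by `E2`, `E3` and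
  -- `E5`. The other three exponentials absorb the linear exponent (`E1`), the square of `E3` (`E4`)
  -- and the final cube of `E5`.
  have e1 := mul_le_exp_of_le hL
  generalize hE1 : Real.exp L = E1 at e1 ⊢
  have h1 : 40 ≤ E1 := by linarith
  have e2 := mul_le_exp_of_le h1
  generalize hE2 : Real.exp E1 = E2 at e2 ⊢
  have h2 : 40 ≤ E2 := by linarith
  have e3 := mul_le_exp_of_le h2
  generalize hE3 : Real.exp E2 = E3 at e3 ⊢
  have h3 : 40 ≤ E3 := by linarith
  have e4 := mul_le_exp_of_le h3
  generalize hE4 : Real.exp E3 = E4 at e4 ⊢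
  have h4 : 40 ≤ E4 := by linarith
  have e5 := mul_le_exp_of_le h4
  generalize hE5 : Real.exp E4 = E5 at e5 ⊢
  have h5 : 40 ≤ E5 := by linarith
  have a1 : (2 : ℝ) ^ (2 * (4 * n + 5)) ≤ E2 := by
    rw [← hE2]
    refine two_pow_le_exp_of_le ?_
    push_cast
    linarith
  have a2 : (2 : ℝ) ^ (2 ^ (2 * (4 * n + 5)) + (4 * n + 5)) ≤ E3 * E3 := by
    rw [← hE3, ← Real.exp_add]
    refine two_pow_le_exp_of_le ?_
    push_cast
    linarith
  have a3 : E3 * E3 * 4 ≤ E4 := by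
    rw [← hE4, ← hE3, ← Real.exp_add]
    have h4e : (4 : ℝ) ≤ Real.exp E2 := by linarith
    refine (mul_le_mul_of_nonneg_left h4e (Real.exp_pos _).le).trans ?_
    rw [← Real.exp_add]
    exact Real.exp_le_exp.2 (by linarith)
  have a4 : (2 : ℝ) ^ (2 * (2 ^ (2 ^ (2 * (4 * n + 5)) + (4 * n + 5)) + 1)) ≤ E5 := by
    rw [← hE5]
    refine two_pow_le_exp_of_le ?_
    push_cast
    nlinarith
  have a5 : (polygonBound n : ℝ) ≤ E5 * E5 := by
    have : (polygonBound n : ℝ) =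
        2 * ((2 : ℝ) ^ (2 * (2 ^ (2 ^ (2 * (4 * n + 5)) + (4 * n + 5)) + 1)) + 1) + 2 := by
      rw [polygonBound, cupBound]
      push_cast
      rfl
    rw [this]
    nlinarith
  calc (polygonBound n : ℝ) * L ≤ E5 * E5 * E5 := by gcongr; linarith
    _ = Real.exp (E4 + E4 + E4) := by rw [Real.exp_add, Real.exp_add, hE5]
    _ ≤ Real.exp E5 := Real.exp_le_exp.2 (by linarith)

lemma exp_log_of_lt {x y : ℝ} (h : Real.exp y < x) : y < Real.log x ∧ Real.exp (Real.log x) = x :=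
  ⟨(Real.lt_log_iff_exp_lt ((Real.exp_pos y).trans h)).2 h,
    Real.exp_log ((Real.exp_pos y).trans h)⟩

lemma exists_polygonsHaveExtension {m : ℕ} {L : ℝ} (hL : 40 ≤ L)
    (hm : Real.exp (Real.exp (Real.exp (Real.exp (Real.exp (Real.exp L))))) = m) :
    ∃ r : ℕ, PolygonsHaveExtension m r ∧ (r : ℝ) ≤ 25 * m * L ^ (-(1 / 2) : ℝ) := by
  have hL0 : (0 : ℝ) < L := by linarith
  have hq : 0 < √L := Real.sqrt_pos.2 hL0
  have hsq : √L * √L = L := Real.mul_self_sqrt hL0.le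
  have hm0 : (0 : ℝ) ≤ m := m.cast_nonneg
  rw [Real.rpow_neg hL0.le, ← Real.sqrt_eq_rpow]
  -- For `L ≤ 25 ^ 2` the claimed bound is at least `m`, and the trivial extension suffices.
  rcases le_or_gt L 625 with h | h
  · refine ⟨m, polygonsHaveExtension_self m, ?_⟩
    rw [← div_eq_mul_inv, le_div_iff₀ hq]
    have : √L ≤ 25 := by
      rw [Real.sqrt_le_left (by norm_num)]
      linarith
    nlinarith
  · have h25 : 25 ≤ √L := Real.le_sqrt_of_sq_le (by linarith)
    -- With `s + 1 = ⌊√L⌋₊` the chain has `s * (s + 2) + 1 = (s + 1) ^ 2 ≤ L` points.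
    obtain ⟨s, hs⟩ : ∃ s : ℕ, ⌊√L⌋₊ = s + 1 := Nat.exists_eq_succ_of_ne_zero
      (Nat.floor_pos.2 (by linarith)).ne'
    have h1 : (s + 1 : ℝ) ≤ √L := by
      have := Nat.floor_le hq.le
      rw [hs] at this
      exact_mod_cast this
    have h2 : √L < s + 1 + 1 := by
      have := Nat.lt_floor_add_one (√L)
      rw [hs] at this
      exact_mod_cast this
    have hs0 : 0 < s := by
      have : (0 : ℝ) < s := by linarith
      exact_mod_cast this
    refine ⟨_, polygonsHaveExtension_div hs0 m, ?_⟩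
    have hN := polygonBound_mul_le (n := s * (s + 2)) hL (by push_cast; nlinarith)
    rw [hm] at hN
    rw [← div_eq_mul_inv, le_div_iff₀ hq]
    push_cast
    -- Since `√L < s + 2` and `s` is large, rounding costs a factor of at most `5 / 4`. With the
    -- constant term the total is at most `6 * m / √L`.
    have hd : (((4 * m / (s + 1) : ℕ)) : ℝ) * √L ≤ 5 * m := by
      have hd' : ((4 * m / (s + 1) : ℕ) : ℝ) * (s + 1) ≤ 4 * m := by
        exact_mod_cast Nat.div_mul_le_self (4 * m) (s + 1)
      have hd0 : (0 : ℝ) ≤ ((4 * m / (s + 1) : ℕ) : ℝ) := Nat.cast_nonneg _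
      nlinarith
    have hb : (polygonBound (s * (s + 2)) : ℝ) * √L ≤ m := by
      refine (mul_le_mul_of_nonneg_left ?_ (Nat.cast_nonneg _)).trans hN
      nlinarith
    rw [add_mul]
    linarith

theorem mainTheorem1 :
    -- the explicit bound
    (∀ (m : ℕ) (P : Set (Fin 2 → ℝ)),
      Real.exp (Real.exp (Real.exp (Real.exp (Real.exp (Real.exp 40))))) < (m : ℝ) →
      IsConvexPolygon m P →
      (extensionComplexity P : ℝ≥0∞) ≤
        ENNReal.ofReal (25 * (m : ℝ) *
          (Real.log (Real.log (Real.log (Real.log (Real.log (Real.log (m : ℝ)))))))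
            ^ (-(1 / 2) : ℝ))) ∧
    -- every convex `n`-gon is a projection of a polytope with `o(n)` facets
    (∃ f : ℕ → ℕ, (fun n : ℕ => (f n : ℝ)) =o[atTop] (fun n : ℕ => (n : ℝ)) ∧
      ∀ (n : ℕ) (P : Set (Fin 2 → ℝ)), IsConvexPolygon n P →
        ∃ (d : ℕ) (Q : Set (Fin d → ℝ)) (π : (Fin d → ℝ) →ₗ[ℝ] (Fin 2 → ℝ)),
          IsExtension P Q π ∧ numFacets Q ≤ (f n : ℕ∞)) ∧
    -- convex polygons do not need linearly many inequalities in the worst case,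
    -- not even for infinitely many values of `n`
    (¬ ∃ c : ℝ, 0 < c ∧ ∃ᶠ n : ℕ in atTop, ∃ P : Set (Fin 2 → ℝ),
      IsConvexPolygon n P ∧
        ENNReal.ofReal (c * (n : ℝ)) ≤ (extensionComplexity P : ℝ≥0∞)) := by
  refine ⟨fun m P hm hP => ?_, ?_, not_frequently_linear_extensionComplexity⟩
  · obtain ⟨h1, g1⟩ := exp_log_of_lt hm
    obtain ⟨h2, g2⟩ := exp_log_of_lt h1
    obtain ⟨h3, g3⟩ := exp_log_of_lt h2
    obtain ⟨h4, g4⟩ := exp_log_of_lt h3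
    obtain ⟨h5, g5⟩ := exp_log_of_lt h4
    obtain ⟨h6, g6⟩ := exp_log_of_lt h5
    obtain ⟨r, hr, hle⟩ := exists_polygonsHaveExtension h6.le
      (by rw [g6, g5, g4, g3, g2, g1] : _ = (m : ℝ))
    refine le_trans ?_ (ENNReal.ofReal_le_ofReal hle)
    rw [ENNReal.ofReal_natCast]
    exact_mod_cast ENat.toENNReal_le.2 (hr.extensionComplexity_le hP)
  · exact ⟨polygonFacetNumber, polygonFacetNumber_isLittleO,
      polygonsHaveExtension_polygonFacetNumber⟩
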